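/- Let $d\ge 2$, $p=\frac{2(d+1)}{d-1}$, $0<\sigma<\frac12$, $R>1$, and put $E=\frac{d-1}{2}\sigma-\frac{(d-1)(d+2)}{2(d+1)}$. Write $x=(x',x_d)\in\mathbb R^{d-1}\times\mathbb R$, let $B_r$ be the open ball of radius $r$ about the origin of $\mathbb R^d$, let $P^{d-1}=\{\xi_d=|\xi'|^2,\ |\xi_j|\le1\ (1\le j\le d-1)\}$, and let $d\omega=\sqrt{1+4|\xi'|^2}\,d\xi'$ be its surface measure. *The example.* For $l\in\mathbb Z^{d-1}$ let $Q_l=\prod_j(l_jR^{-\sigma}-R^{-1},\,l_jR^{-\sigma}+R^{-1})$. Let $h(\xi)=\sum_{1\le l_1,\dots,l_{d-1}<R^\sigma}1_{Q_l}(\xi')$ and $g(x)=\int h(\xi)e^{2\pi i x\cdot\xi}\,d\omega(\xi)$, so that $\hat g=h\,d\omega$. Let $\Lambda=\{(n_1R^\sigma,\dots,n_{d-1}R^\sigma,n_dR^{2\sigma}):n_j\in\mathbb Z\}$ and let $X=\{x\in B_R:\operatorname{dist}(x,\Lambda)<1\}$. *Caps and weights.* Divide $\mathbb R^{d-1}$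 into the cubes $\tau$ of a half-open axis-parallel grid, in any position, with side length $s\in[\frac12R^{-1/2},R^{-1/2}]$. The caps are the sets $\theta=\{\xi\in P^{d-1}:\xi'\in\tau\}$, and $g_\theta(x)=\int_\theta h(\xi)e^{2\pi ix\cdot\xi}\,d\omega(\xi)$. Call the grid *adapted* if for each $l$ in the sum, $Q_l\cap[-1,1]^{d-1}$ lies in one cube of the grid. Let $w$ be a measurable weight with $w\ge A^{-1}$ on $B_R$ and $w(x)\le A(1+|x|/R)^{-(d+1)}$ everywhere, where $A\ge1$. *Wave packets.* For each $\theta$ choose a rectangular box of dimensions $KR^{-1/2}\times\dots\times KR^{-1/2}\times KR^{-1}$ containing $\theta$, where $K\ge1$. Let $T_\theta$ be the dual box centred at the origin (same axes, inverse side lengths), and tile $\mathbb R^d$ by the translates $T$ of (the half-open) $T_\theta$, one of them being $T_\theta$ itself. Fix a Schwartz function $\eta$ on $\mathbb R^d$ with $\hat\eta$ compactly supported, $\sum_{m\in\mathbb Z^d}\eta(\cdot-m)=1$, and $\eta\ne0$ on $[-\frac12,\frac12]^d$. Let $\psi_T$ be the composition of $\eta$ with the affine map taking $T$ to $[-\frac12,\frac12)^d$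 (translate $T$ to the origin, then rescale along the axes of the box). Put $g_{\theta,T}=\psi_Tg_\theta$, so that $\sum_Tg_{\theta,T}=g_\theta$. The magnitude of $g_{\theta,T}$ is $\sup_T|g_{\theta,T}|$. For $\lambda>0$ let $M_\lambda(x)$ be the number of pairs $(\theta,T)$ such that $T$ meets $B_R$, $x\in T$, and $g_{\theta,T}$ has magnitude at least $\lambda$. Let $M_\lambda=\sup_{x\in X}M_\lambda(x)$. Write $Y\sim Z$ for $C^{-1}Z\le Y\le CZ$. In each part below there is a constant $C\ge1$, depending only on the parameters named there, for which the assertions hold for all $0<\sigma<\frac12$ and $R>1$ (and for all grids, weights, boxes and $K$ as above). 1. ($C$ depends only on $d$.) $|g|\le CR^{(d-1)(\sigma-1)}$ everywhere, and $|g|\ge C^{-1}R^{(d-1)(\sigma-1)}$ at all points within distance $C^{-1}$ of $\Lambda\cap B_{R/C}$. Moreover $|X|\sim R^{d-(d+1)\sigma}$ and $$\|g\|_{L^p(X)}\sim R^{E}.$$ 2. ($C$ depends only on $d,A$.) For all $\theta$, $|g_\theta|\le CR^{-(d-1)}$ everywhere and $\|g_\theta\|_{L^p(w)}\le CR^{-(d-1)+d/p}$.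 If the grid is adapted, then for each $\theta$ with $g_\theta\not\equiv0$ one has $|g_\theta|\ge C^{-1}R^{-(d-1)}$ on $B_{R/C}$ and $\|g_\theta\|_{L^p(w)}\sim R^{-(d-1)+d/p}$. For every grid, $g$ is sharp for Bourgain–Demeter $\ell^2$ decoupling up to the $R^\varepsilon$-loss: $$\Big(\sum_\theta\|g_\theta\|_{L^p(w)}^2\Big)^{1/2}\sim R^{E},\qquad \Big(\sum_\theta\|g_\theta\|_{L^p(w)}^2\Big)^{1/2}\le C\|g\|_{L^p(B_R)}.$$ 3. ($C$ depends only on $d,A,\eta$.) All $g_{\theta,T}$ have magnitude at most $CR^{-(d-1)}$. If the grid is adapted, all $g_{\theta,T}$ with $g_\theta\not\equiv0$ and $T\cap B_{R/C}\neq\emptyset$ have magnitude at least $C^{-1}R^{-(d-1)}$. For all $0<\lambda\le C^{-1}R^{-(d-1)}$: $M_\lambda(y)\ge C^{-1}R^{(d-1)\sigma}$ for each $y\in\Lambda\cap B_{R/C}$; $M_\lambda\sim R^{(d-1)\sigma}$; and for every real $\varepsilon$ the right-hand side of the refined decoupling inequality satisfies $$R^\varepsilon M_\lambda^{\frac12-\frac1p}\Big(\sum_\theta\|g_\theta\|_{L^p(w)}^p\Big)^{1/p}\sim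 R^{E+\varepsilon},\qquad R^\varepsilon M_\lambda^{\frac12-\frac1p}\Big(\sum_\theta\|g_\theta\|_{L^p(w)}^p\Big)^{1/p}\le CR^\varepsilon\|g\|_{L^p(X)},$$ so that $g$ is sharp for refined decoupling up to the $R^\varepsilon$-loss. 4. If $R\ge16$, an adapted grid exists. -/

import Mathlib

open MeasureTheory Set
open scoped ENNReal NNReal SchwartzMap FourierTransform

noncomputable section

namespace BBCRV

/-! Throughout, the ambient dimension is `d = n + 1`; a point of `ℝ^d` is written `(x', x_d)` with
`x' = (x_1, …, x_n)`, so that `d - 1 = n`, and `x_d` is the coordinate of index `Fin.last n`. -/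

/-- `ℝ^d` with its Euclidean norm and Lebesgue measure. -/
abbrev E (d : ℕ) : Type := EuclideanSpace ℝ (Fin d)

/-- The first `n` coordinates `x'` of a point of `ℝ^(n+1)`. -/
def horiz {n : ℕ} (x : E (n + 1)) : Fin n → ℝ := fun i => x i.castSucc

/-- The point `(ξ', |ξ'|²)` of the paraboloid above `ξ'`. -/
def paraLift {n : ℕ} (ξ : Fin n → ℝ) : E (n + 1) :=
  WithLp.toLp 2 (Fin.snoc (α := fun _ => ℝ) ξ (∑ i, ξ i ^ 2))

/-- The truncated paraboloid `P^(d-1)`. -/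
def paraboloid (n : ℕ) : Set (E (n + 1)) :=
  {ξ | ξ (Fin.last n) = ∑ i, horiz ξ i ^ 2 ∧ ∀ i, |horiz ξ i| ≤ 1}

/-- The hypersurface measure `dω` on `P^(d-1)`: the image under `ξ' ↦ (ξ', |ξ'|²)` of
`√(1 + 4|ξ'|²) dξ'` on the cube `[-1,1]^(d-1)`. -/
def surfaceMeasure (n : ℕ) : Measure (E (n + 1)) :=
  Measure.map paraLift
    ((volume.restrict (Icc (-1 : Fin n → ℝ) 1)).withDensity
      (fun ξ => ENNReal.ofReal (Real.sqrt (1 + 4 * ∑ i, ξ i ^ 2))))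

/-- The function `v` with `v̂ = f dω`, i.e. `v(x) = ∫ f(ξ) e^{2πi x·ξ} dω(ξ)`. -/
def ext {n : ℕ} (f : E (n + 1) → ℝ) (x : E (n + 1)) : ℂ :=
  ∫ ξ, Complex.exp (2 * Real.pi * Complex.I * (inner ℝ x ξ : ℝ)) * (f ξ : ℂ) ∂(surfaceMeasure n)

/-! ### The example -/

/-- The integer vectors `l` with `1 ≤ l_1, …, l_{d-1} < R^σ` (for integers, `l < R^σ` is the same
as `l < ⌈R^σ⌉`). -/
def freqs (n : ℕ) (σ R : ℝ) : Finset (Fin n → ℤ) :=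
  Fintype.piFinset fun _ => Finset.Ico (1 : ℤ) ⌈R ^ σ⌉

/-- The open box `∏ (l_i R^{-σ} - R^{-1}, l_i R^{-σ} + R^{-1})`. -/
def freqBox {n : ℕ} (σ R : ℝ) (l : Fin n → ℤ) : Set (Fin n → ℝ) :=
  {ξ | ∀ i, ξ i ∈ Ioo ((l i : ℝ) * R ^ (-σ) - R⁻¹) ((l i : ℝ) * R ^ (-σ) + R⁻¹)}

/-- The density `h`. -/
def hDensity (n : ℕ) (σ R : ℝ) (ξ : E (n + 1)) : ℝ :=
  ∑ l ∈ freqs n σ R, (freqBox σ R l).indicator (fun _ => (1 : ℝ)) (horiz ξ)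

/-- The Barceló–Bennett–Carbery–Ruiz–Vilela function `g`, with `ĝ = h dω`. -/
def g (n : ℕ) (σ R : ℝ) : E (n + 1) → ℂ := ext (hDensity n σ R)

/-- The points `(n_1 R^σ, …, n_{d-1} R^σ, n_d R^{2σ})`. -/
def lattice (n : ℕ) (σ R : ℝ) : Set (E (n + 1)) :=
  {x | ∃ m : Fin (n + 1) → ℤ,
    (∀ i : Fin n, x i.castSucc = (m i.castSucc : ℝ) * R ^ σ) ∧
      x (Fin.last n) = (m (Fin.last n) : ℝ) * R ^ (2 * σ)}

/-- The part in `B_R` of the `1`-neighbourhood of the lattice. -/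
def X (n : ℕ) (σ R : ℝ) : Set (E (n + 1)) :=
  Metric.thickening 1 (lattice n σ R) ∩ Metric.ball 0 R

/-- `p = 2(d+1)/(d-1)`. -/
def pCrit (n : ℕ) : ℝ := 2 * (((n + 1 : ℕ) : ℝ) + 1) / (((n + 1 : ℕ) : ℝ) - 1)

/-- `((d-1)/2) σ - (d-1)(d+2)/(2(d+1))`. -/
def sharpExp (n : ℕ) (σ : ℝ) : ℝ :=
  (((n + 1 : ℕ) : ℝ) - 1) / 2 * σ
    - (((n + 1 : ℕ) : ℝ) - 1) * (((n + 1 : ℕ) : ℝ) + 2) / (2 * (((n + 1 : ℕ) : ℝ) + 1))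

/-- `C⁻¹ B ≤ Y ≤ C B`. -/
def Comparable (C : ℝ) (Y : ℝ≥0∞) (B : ℝ) : Prop :=
  ENNReal.ofReal (C⁻¹ * B) ≤ Y ∧ Y ≤ ENNReal.ofReal (C * B)

/-! ### Caps, tubes and wave packets -/

/-- `s` is an admissible side length of the caps `θ` at scale `R`: it is `R^{-1/2}`, up to a factor
at most `2` that leaves room to fit the grid to `[-1,1]^(d-1)`. -/
def IsCapSide (R s : ℝ) : Prop := R ^ (-(1 / 2 : ℝ)) / 2 ≤ s ∧ s ≤ R ^ (-(1 / 2 : ℝ))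

/-- The cube of index `k` in the grid of `ℝ^(d-1)` with side `s` and corner `a`. -/
def gridCube {n : ℕ} (s : ℝ) (a : Fin n → ℝ) (k : Fin n → ℤ) : Set (Fin n → ℝ) :=
  {ξ | ∀ i, ξ i ∈ Ico (a i + s * k i) (a i + s * (k i + 1))}

/-- The cap `θ` of index `k`: the part of `P^(d-1)` above a grid cube. -/
def cap {n : ℕ} (s : ℝ) (a : Fin n → ℝ) (k : Fin n → ℤ) : Set (E (n + 1)) :=
  {ξ | ξ ∈ paraboloid n ∧ horiz ξ ∈ gridCube s a k}

/-- `v_θ` for `v̂ = f dω`: the part of `v` with frequencies in `θ`. -/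
def capPart {n : ℕ} (f : E (n + 1) → ℝ) (s : ℝ) (a : Fin n → ℝ) (k : Fin n → ℤ) :
    E (n + 1) → ℂ :=
  ext ((cap s a k).indicator f)

/-- The side lengths `K R^{-1/2}, …, K R^{-1/2}, K R^{-1}` of the boxes around the caps. -/
def boxWidth {n : ℕ} (R K : ℝ) (i : Fin (n + 1)) : ℝ :=
  if i = Fin.last n then K * R⁻¹ else K * R ^ (-(1 / 2 : ℝ))

/-- A choice, for each cap `θ`, of a rectangular box of dimensions
`K R^{-1/2} × ⋯ × K R^{-1/2} × K R^{-1}` that contains `θ`. -/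
structure CapBoxes (n : ℕ) (R K s : ℝ) (a : Fin n → ℝ) where
  /-- the directions of the sides -/
  basis : (Fin n → ℤ) → OrthonormalBasis (Fin (n + 1)) ℝ (E (n + 1))
  /-- the centre -/
  center : (Fin n → ℤ) → E (n + 1)
  cap_subset : ∀ k, ∀ ξ ∈ cap s a k, ∀ i,
    |inner ℝ (basis k i) (ξ - center k)| ≤ boxWidth R K i / 2

namespace CapBoxes

variable {n : ℕ} {R K s : ℝ} {a : Fin n → ℝ}

/-- Coordinates in which the dual box `T_θ` (centred at the origin, with side lengths the inverses
of those of the box of `θ`) is the cube `[-1/2, 1/2]^d`. -/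
def coord (𝔅 : CapBoxes n R K s a) (k : Fin n → ℤ) (x : E (n + 1)) : E (n + 1) :=
  WithLp.toLp 2 fun i => boxWidth R K i * inner ℝ (𝔅.basis k i) x

/-- The tile `T` of index `m` in the tiling of space by translates of `T_θ`. -/
def tube (𝔅 : CapBoxes n R K s a) (k : Fin n → ℤ) (m : Fin (n + 1) → ℤ) : Set (E (n + 1)) :=
  {x | ∀ i, 𝔅.coord k x i ∈ Ico ((m i : ℝ) - 1 / 2) ((m i : ℝ) + 1 / 2)}

end CapBoxes

/-- The integer vector `m` as a point of `ℝ^d`. -/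
def intVec {d : ℕ} (m : Fin d → ℤ) : E d := WithLp.toLp 2 fun i => (m i : ℝ)

/-- A profile for the smooth cutoffs of the wave packet decomposition: a Schwartz function with
compactly supported Fourier transform, whose integer translates sum to `1`, and which does not
vanish on the cube `[-1/2, 1/2]^d`. -/
structure Profile (d : ℕ) where
  /-- the function -/
  η : 𝓢(E d, ℂ)
  fourier_support : HasCompactSupport (𝓕 (η : E d → ℂ))
  sum_translates : ∀ y : E d, HasSum (fun m : Fin d → ℤ => η (y - intVec m)) 1
  ne_zero : ∀ y : E d, (∀ i, |y i| ≤ 1 / 2) → η y ≠ 0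

variable {n : ℕ} {R K s : ℝ} {a : Fin n → ℝ}

/-- The wave packet `v_{θ,T}`, namely `v_θ` times the cutoff adapted to `T`; thus
`∑_T v_{θ,T} = v_θ`. -/
def wavePacket (φ : Profile (n + 1)) (𝔅 : CapBoxes n R K s a) (f : E (n + 1) → ℝ)
    (k : Fin n → ℤ) (m : Fin (n + 1) → ℤ) (x : E (n + 1)) : ℂ :=
  φ.η (𝔅.coord k x - intVec m) * capPart f s a k x

/-- The magnitude of `v_{θ,T}`: the size of `|v_{θ,T}|` on `T`. -/
def magnitude (φ : Profile (n + 1)) (𝔅 : CapBoxes n R K s a) (f : E (n + 1) → ℝ)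
    (k : Fin n → ℤ) (m : Fin (n + 1) → ℤ) : ℝ≥0∞ :=
  ⨆ x ∈ 𝔅.tube k m, ‖wavePacket φ 𝔅 f k m x‖ₑ

/-- The wave packets in `B_R` of magnitude at least `lam` whose tube contains `x`. -/
def packetsAt (φ : Profile (n + 1)) (𝔅 : CapBoxes n R K s a) (f : E (n + 1) → ℝ)
    (lam : ℝ) (x : E (n + 1)) : Set ((Fin n → ℤ) × (Fin (n + 1) → ℤ)) :=
  {q | (𝔅.tube q.1 q.2 ∩ Metric.ball 0 R).Nonempty ∧ x ∈ 𝔅.tube q.1 q.2 ∧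
    ENNReal.ofReal lam ≤ magnitude φ 𝔅 f q.1 q.2}

/-- The least `M` such that each `x ∈ Y` hits at most `M` wave packets (of magnitude at least
`lam`). -/
def multiplicity (φ : Profile (n + 1)) (𝔅 : CapBoxes n R K s a) (f : E (n + 1) → ℝ)
    (lam : ℝ) (Y : Set (E (n + 1))) : ℝ≥0∞ :=
  ⨆ x ∈ Y, ((packetsAt φ 𝔅 f lam x).encard : ℝ≥0∞)

/-! ### The two sides of the decoupling inequalities -/

/-- `w` is a weight adapted to `B_R`: comparable to `1` on `B_R` and decaying away from it. -/
def IsBallWeight (n : ℕ) (A R : ℝ) (w : E (n + 1) → ℝ≥0∞) : Prop :=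
  Measurable w ∧ (∀ x ∈ Metric.ball (0 : E (n + 1)) R, ENNReal.ofReal A⁻¹ ≤ w x) ∧
    ∀ x, w x ≤ ENNReal.ofReal (A * (1 + ‖x‖ / R) ^ (-((n : ℝ) + 2)))

/-- `‖v‖_{L^p(Y)}` at the critical exponent `p`. -/
def lpOn (v : E (n + 1) → ℂ) (Y : Set (E (n + 1))) : ℝ≥0∞ :=
  eLpNorm v (ENNReal.ofReal (pCrit n)) (volume.restrict Y)

/-- `‖v_θ‖_{L^p(w)}` at the critical exponent `p`. -/
def capNorm (f : E (n + 1) → ℝ) (s : ℝ) (a : Fin n → ℝ) (w : E (n + 1) → ℝ≥0∞)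
    (k : Fin n → ℤ) : ℝ≥0∞ :=
  eLpNorm (capPart f s a k) (ENNReal.ofReal (pCrit n)) (volume.withDensity w)

/-- `(∑_θ ‖v_θ‖_{L^p(w)}^q)^{1/q}`. -/
def capSum (f : E (n + 1) → ℝ) (s : ℝ) (a : Fin n → ℝ) (w : E (n + 1) → ℝ≥0∞) (q : ℝ) : ℝ≥0∞ :=
  (∑' k : Fin n → ℤ, capNorm f s a w k ^ q) ^ (1 / q)

/-- The right-hand side `R^ε M^{1/2 - 1/p} (∑_θ ‖v_θ‖_{L^p(w)}^p)^{1/p}` of the refined decoupling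
inequality on `Y`. -/
def refinedRHS (φ : Profile (n + 1)) (𝔅 : CapBoxes n R K s a) (f : E (n + 1) → ℝ)
    (lam : ℝ) (Y : Set (E (n + 1))) (w : E (n + 1) → ℝ≥0∞) (ε : ℝ) : ℝ≥0∞ :=
  ENNReal.ofReal (R ^ ε) * multiplicity φ 𝔅 f lam Y ^ (1 / 2 - 1 / pCrit n)
    * capSum f s a w (pCrit n)

/-- The grid of caps is adapted to `g`: no frequency box of `g` is divided between caps. -/
def IsAdapted (n : ℕ) (σ R s : ℝ) (a : Fin n → ℝ) : Prop :=
  ∀ l ∈ freqs n σ R, ∃ k, freqBox σ R l ∩ Icc (-1 : Fin n → ℝ) 1 ⊆ gridCube s a k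

end BBCRV

/-!
At a point of `Λ` every phase `x · ξ` with `ξ = (l R^{-σ}, |l|² R^{-2σ})` is an integer. Since the
support of `h` lies within `O(R^{-1})` of such frequencies, near `Λ ∩ B_{R/C}` all the contributions
to `g` are within a sixth of a turn of each other, and `|g|` attains its trivial upper bound up to a
constant. Counting lattice points in `B_R` then gives `|X|` and `‖g‖_{L^p(X)}`.

A cap meets boundedly many boxes `Q_l`, so `|g_θ| ≲ R^{-(d-1)}`. For an adapted grid the frequencies
of `g_θ` lie in a single box and there is no cancellation on `B_{R/C}`. In an arbitrary grid several
boxes can meet a cap and interfere destructively away from `Λ`, but since `h ≥ 0`, testing `g_θ`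
against a modulated cutoff of `B_R` that is nonnegative and has a nonnegative Fourier transform
still bounds its mean over `B_R`, hence its `L^p(w)` norm, from below.

Each of the `≈ R^{(d-1)σ}` boxes has a large part in some cap, and these caps are distinct because
their side `R^{-1/2}` is less than the spacing `R^{-σ}` of the boxes. Through each point passes
exactly one tube of each cap, so the multiplicity is `≈ R^{(d-1)σ}` as well, and with
`p = 2(d+1)/(d-1)` all the powers of `R` agree.
-/

namespace BBCRV

/-! ### Oscillatory integrals of nonnegative densities -/

theorem half_le_re_fourierChar {t : ℝ} {z : ℤ} (h : |t - z| ≤ 1 / 6) : 1 / 2 ≤ (𝐞 t : ℂ).re := by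
  have hcos : (𝐞 t : ℂ).re = Real.cos |2 * Real.pi * (t - z)| := by
    rw [Real.fourierChar_apply, Complex.exp_ofReal_mul_I_re, Real.cos_abs,
      ← Real.cos_sub_int_mul_two_pi _ z]
    ring_nf
  rw [hcos, ← Real.cos_pi_div_three, abs_mul, abs_of_pos Real.two_pi_pos]
  apply Real.cos_le_cos_of_nonneg_of_le_pi (by positivity) (by linarith [Real.pi_pos])
  nlinarith [Real.pi_pos]

theorem fourierChar_sub_smul (t u : ℝ) (z : ℂ) : 𝐞 (t - u) • z = (𝐞 (-u) : ℂ) * 𝐞 t • z := by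
  rw [sub_eq_neg_add, AddChar.map_add_eq_mul, mul_smul, Circle.smul_def, smul_eq_mul]

theorem integrable_fourierChar_smul {α : Type*} [MeasurableSpace α] {μ : Measure α} {f φ : α → ℝ}
    (hφ : AEMeasurable φ μ) (hf : Integrable f μ) :
    Integrable (fun ξ ↦ 𝐞 (φ ξ) • (f ξ : ℂ)) μ := by
  have he : AEStronglyMeasurable (fun ξ ↦ (𝐞 (φ ξ) : ℂ)) μ :=
    ((continuous_subtype_val.comp Real.continuous_fourierChar).measurable.comp_aemeasurable
      hφ).aestronglyMeasurable
  simpa only [Circle.smul_def, smul_eq_mul, RCLike.ofReal_eq_complex_ofReal] using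
    hf.ofReal (𝕜 := ℂ).bdd_mul he (ae_of_all _ fun ξ ↦ (Circle.norm_coe _).le)

/-- The phases lie within a sixth of a turn of `t`, so there is no cancellation. -/
theorem half_integral_le_norm_integral_fourierChar_smul {α : Type*} [MeasurableSpace α]
    {μ : Measure α} {f φ : α → ℝ} (hφ : AEMeasurable φ μ) (hf0 : 0 ≤ f) (hf : Integrable f μ)
    (t : ℝ) (h : ∀ᵐ ξ ∂μ, f ξ ≠ 0 → ∃ z : ℤ, |φ ξ - t - z| ≤ 1 / 6) :
    (1 / 2) * ∫ ξ, f ξ ∂μ ≤ ‖∫ ξ, 𝐞 (φ ξ) • (f ξ : ℂ) ∂μ‖ := by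
  have hI : Integrable (fun ξ ↦ 𝐞 (φ ξ - t) • (f ξ : ℂ)) μ :=
    integrable_fourierChar_smul (hφ.sub_const t) hf
  have hrotate : ∫ ξ, 𝐞 (φ ξ - t) • (f ξ : ℂ) ∂μ =
      (𝐞 (-t) : ℂ) * ∫ ξ, 𝐞 (φ ξ) • (f ξ : ℂ) ∂μ := by
    rw [← integral_const_mul]
    simp only [fourierChar_sub_smul]
  calc (1 / 2) * ∫ ξ, f ξ ∂μ = ∫ ξ, (1 / 2) * f ξ ∂μ := (integral_const_mul _ _).symm
    _ ≤ ∫ ξ, (𝐞 (φ ξ - t) • (f ξ : ℂ)).re ∂μ := by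
        refine integral_mono_ae (hf.const_mul _) hI.re ?_
        filter_upwards [h] with ξ hξ
        rw [Circle.smul_def, smul_eq_mul, Complex.re_mul_ofReal]
        by_cases hz : f ξ = 0
        · simp [hz]
        obtain ⟨z, hz⟩ := hξ hz
        exact mul_le_mul_of_nonneg_right (half_le_re_fourierChar hz) (hf0 ξ)
    _ = (∫ ξ, 𝐞 (φ ξ - t) • (f ξ : ℂ) ∂μ).re := integral_re hI
    _ ≤ ‖∫ ξ, 𝐞 (φ ξ - t) • (f ξ : ℂ) ∂μ‖ := Complex.re_le_norm _
    _ = ‖∫ ξ, 𝐞 (φ ξ) • (f ξ : ℂ) ∂μ‖ := by rw [hrotate, norm_mul, Circle.norm_coe, one_mul]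

section DensityFourierInv

variable {V : Type*} [NormedAddCommGroup V] [InnerProductSpace ℝ V] [MeasurableSpace V]
  {μ : Measure V} {f : V → ℝ}

/-- The function `v` with `v̂ = f dμ`, for a real density `f` with respect to an arbitrary
measure `μ`. -/
def densityFourierInv (μ : Measure V) (f : V → ℝ) (x : V) : ℂ :=
  ∫ ξ, 𝐞 (inner ℝ x ξ) • (f ξ : ℂ) ∂μ

theorem norm_densityFourierInv_le (hf : 0 ≤ f) (x : V) :
    ‖densityFourierInv μ f x‖ ≤ ∫ ξ, f ξ ∂μ := by
  refine (norm_integral_le_integral_norm _).trans_eq (integral_congr_ae (ae_of_all _ fun ξ ↦ ?_))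
  simp only [Circle.norm_smul, Complex.norm_real, Real.norm_of_nonneg (hf ξ)]

theorem integral_prod_fourierChar_inner_sub (B : Measure V) [IsFiniteMeasure B] (ζ : V) :
    ∫ q : V × V, (𝐞 (inner ℝ (q.1 - q.2) ζ) : ℂ) ∂(B.prod B) =
      ((‖∫ u, (𝐞 (inner ℝ u ζ) : ℂ) ∂B‖ ^ 2 : ℝ) : ℂ) := by
  have hsplit (q : V × V) : (𝐞 (inner ℝ (q.1 - q.2) ζ) : ℂ) =
      (𝐞 (inner ℝ q.1 ζ) : ℂ) * (starRingEnd ℂ) (𝐞 (inner ℝ q.2 ζ) : ℂ) := by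
    rw [inner_sub_left, sub_eq_add_neg, AddChar.map_add_eq_mul, AddChar.map_neg_eq_inv,
      Circle.coe_mul, Circle.coe_inv_eq_conj]
  simp only [hsplit]
  rw [integral_prod_mul (μ := B) (ν := B) (fun u ↦ (𝐞 (inner ℝ u ζ) : ℂ))
    (fun v ↦ (starRingEnd ℂ) (𝐞 (inner ℝ v ζ) : ℂ)), integral_conj, Complex.mul_conj,
    Complex.normSq_eq_norm_sq]

variable [BorelSpace V]

theorem continuous_densityFourierInv (hf : Integrable f μ) :
    Continuous (densityFourierInv μ f) := by
  refine continuous_of_dominated (bound := fun ξ ↦ ‖f ξ‖) (fun x ↦ ?_) (fun x ↦ ?_) hf.norm ?_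
  · exact (integrable_fourierChar_smul (by fun_prop) hf).aestronglyMeasurable
  · exact ae_of_all _ fun ξ ↦ by rw [Circle.norm_smul, Complex.norm_real]
  · exact ae_of_all _ fun ξ ↦ (Real.continuous_fourierChar.comp (by fun_prop)).smul
      continuous_const

variable [SecondCountableTopology V]

theorem integrable_prod_fourierChar_sub_smul [SFinite μ] (hf : Integrable f μ) (ξ₀ : V)
    (B : Measure V) [IsFiniteMeasure B] :
    Integrable (fun z : (V × V) × V ↦ 𝐞 (inner ℝ (z.1.1 - z.1.2) (z.2 - ξ₀)) • (f z.2 : ℂ))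
      ((B.prod B).prod μ) :=
  integrable_fourierChar_smul (f := fun z : (V × V) × V ↦ f z.2)
    (φ := fun z : (V × V) × V ↦ inner ℝ (z.1.1 - z.1.2) (z.2 - ξ₀)) (by fun_prop) (hf.comp_snd _)

theorem integrable_sq_norm_integral_fourierChar_mul [SFinite μ] (hf : Integrable f μ) (ξ₀ : V)
    (B : Measure V) [IsFiniteMeasure B] :
    Integrable (fun ξ ↦ ‖∫ u, (𝐞 (inner ℝ u (ξ - ξ₀)) : ℂ) ∂B‖ ^ 2 * f ξ) μ := by
  have h := (integrable_prod_fourierChar_sub_smul hf ξ₀ B).integral_prod_right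
  simp only [Circle.smul_def, smul_eq_mul, integral_mul_const,
    integral_prod_fourierChar_inner_sub, ← Complex.ofReal_mul] at h
  exact h.re

/-- Testing `v` against the positive definite cutoff `B ∗ B̃` modulated to the frequency `ξ₀`: if
`f ≥ 0`, frequencies away from `ξ₀` contribute a nonnegative amount. -/
theorem integral_fourierChar_smul_densityFourierInv_sub [SFinite μ] (hf : Integrable f μ)
    (ξ₀ : V) (B : Measure V) [IsFiniteMeasure B] :
    ∫ q : V × V, 𝐞 (-inner ℝ (q.1 - q.2) ξ₀) • densityFourierInv μ f (q.1 - q.2) ∂(B.prod B) =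
      ((∫ ξ, ‖∫ u, (𝐞 (inner ℝ u (ξ - ξ₀)) : ℂ) ∂B‖ ^ 2 * f ξ ∂μ : ℝ) : ℂ) := by
  have hmod (x : V) : 𝐞 (-inner ℝ x ξ₀) • densityFourierInv μ f x =
      ∫ ξ, 𝐞 (inner ℝ x (ξ - ξ₀)) • (f ξ : ℂ) ∂μ := by
    rw [densityFourierInv, Circle.smul_def, smul_eq_mul, ← integral_const_mul]
    simp only [inner_sub_right, fourierChar_sub_smul]
  simp only [hmod]
  rw [integral_integral_swap (integrable_prod_fourierChar_sub_smul hf ξ₀ B),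
    ← integral_complex_ofReal]
  simp only [Circle.smul_def, smul_eq_mul, integral_mul_const,
    integral_prod_fourierChar_inner_sub, Complex.ofReal_mul]

end DensityFourierInv

section Ball

variable {V : Type*} [NormedAddCommGroup V] [InnerProductSpace ℝ V] [FiniteDimensional ℝ V]
  [MeasurableSpace V] [BorelSpace V] {μ : Measure V} {f : V → ℝ} {r : ℝ}

open Metric

theorem half_volume_ball_le_norm_integral_fourierChar {ζ : V} (h : r * ‖ζ‖ ≤ 1 / 6) :
    (1 / 2) * volume.real (ball (0 : V) r) ≤
      ‖∫ u in ball (0 : V) r, (𝐞 (inner ℝ u ζ) : ℂ)‖ := by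
  have hphase : ∀ᵐ u ∂volume.restrict (ball (0 : V) r), (1 : ℝ) ≠ 0 →
      ∃ z : ℤ, |inner ℝ u ζ - 0 - z| ≤ 1 / 6 := by
    filter_upwards [ae_restrict_mem measurableSet_ball] with u hu _
    refine ⟨0, ?_⟩
    rw [Int.cast_zero, sub_zero, sub_zero]
    refine (abs_real_inner_le_norm u ζ).trans (le_trans ?_ h)
    exact mul_le_mul_of_nonneg_right (mem_ball_zero_iff.1 hu).le (norm_nonneg _)
  simpa [Circle.smul_def] using half_integral_le_norm_integral_fourierChar_smul
    (f := fun _ ↦ 1) (by fun_prop) (fun _ ↦ zero_le_one)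
    (integrableOn_const measure_ball_lt_top.ne) 0 hphase

theorem lintegral_ball_lintegral_ball_sub_le (F : V → ℝ≥0∞) (r : ℝ) :
    ∫⁻ u in ball (0 : V) r, ∫⁻ v in ball (0 : V) r, F (u - v) ≤
      volume (ball (0 : V) r) * ∫⁻ x in ball (0 : V) (2 * r), F x := by
  rw [mul_comm, ← setLIntegral_const]
  refine setLIntegral_mono' measurableSet_ball fun u hu ↦ ?_
  rw [← lintegral_indicator measurableSet_ball, ← lintegral_indicator measurableSet_ball,
    ← lintegral_sub_left_eq_self ((ball (0 : V) (2 * r)).indicator F) u]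
  refine lintegral_mono fun v ↦ ?_
  by_cases hv : v ∈ ball (0 : V) r
  · rw [indicator_of_mem hv, indicator_of_mem]
    rw [mem_ball_zero_iff] at *
    exact (norm_sub_le u v).trans_lt (by linarith)
  · simp only [indicator_of_notMem hv, zero_le]

theorem ofReal_integral_sq_norm_mul_le_lintegral_ball [SFinite μ] (hf0 : 0 ≤ f)
    (hf : Integrable f μ) (ξ₀ : V) (r : ℝ) :
    ENNReal.ofReal
        (∫ ξ, ‖∫ u in ball (0 : V) r, (𝐞 (inner ℝ u (ξ - ξ₀)) : ℂ)‖ ^ 2 * f ξ ∂μ) ≤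
      volume (ball (0 : V) r) * ∫⁻ x in ball (0 : V) (2 * r), ‖densityFourierInv μ f x‖ₑ := by
  have : IsFiniteMeasure (volume.restrict (ball (0 : V) r)) :=
    ⟨by simpa using measure_ball_lt_top⟩
  have hpos : 0 ≤ ∫ ξ, ‖∫ u in ball (0 : V) r, (𝐞 (inner ℝ u (ξ - ξ₀)) : ℂ)‖ ^ 2 * f ξ ∂μ :=
    integral_nonneg fun ξ ↦ mul_nonneg (by positivity) (hf0 ξ)
  calc _ = ‖∫ q : V × V, 𝐞 (-inner ℝ (q.1 - q.2) ξ₀) • densityFourierInv μ f (q.1 - q.2)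
          ∂((volume.restrict (ball 0 r)).prod (volume.restrict (ball 0 r)))‖ₑ := by
        rw [integral_fourierChar_smul_densityFourierInv_sub hf, ← ofReal_norm, Complex.norm_real,
          Real.norm_of_nonneg hpos]
    _ ≤ ∫⁻ q : V × V, ‖densityFourierInv μ f (q.1 - q.2)‖ₑ
          ∂((volume.restrict (ball 0 r)).prod (volume.restrict (ball 0 r))) := by
        refine (enorm_integral_le_lintegral_enorm _).trans_eq (lintegral_congr fun q ↦ ?_)
        rw [← ofReal_norm, Circle.norm_smul, ofReal_norm]
    _ = ∫⁻ u in ball (0 : V) r, ∫⁻ v in ball (0 : V) r, ‖densityFourierInv μ f (u - v)‖ₑ :=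
        lintegral_prod _ ((continuous_densityFourierInv hf).comp
          (continuous_fst.sub continuous_snd)).enorm.aemeasurable
    _ ≤ _ := lintegral_ball_lintegral_ball_sub_le (fun x ↦ ‖densityFourierInv μ f x‖ₑ) r

theorem le_integral_sq_norm_mul [IsFiniteMeasure μ] (hf0 : 0 ≤ f) (hf : Integrable f μ) (ξ₀ : V)
    {S : Set V} (hS : MeasurableSet S)
    (hSf : ∀ᵐ ξ ∂μ, ξ ∈ S → 1 ≤ f ξ ∧ r * ‖ξ - ξ₀‖ ≤ 1 / 6) :
    (1 / 4) * volume.real (ball (0 : V) r) ^ 2 * μ.real S ≤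
      ∫ ξ, ‖∫ u in ball (0 : V) r, (𝐞 (inner ℝ u (ξ - ξ₀)) : ℂ)‖ ^ 2 * f ξ ∂μ := by
  have : IsFiniteMeasure (volume.restrict (ball (0 : V) r)) :=
    ⟨by simpa using measure_ball_lt_top⟩
  set V₀ := volume.real (ball (0 : V) r)
  calc (1 / 4) * V₀ ^ 2 * μ.real S = ∫ ξ, S.indicator (fun _ ↦ (1 / 4) * V₀ ^ 2) ξ ∂μ := by
        rw [integral_indicator_const _ hS, smul_eq_mul, mul_comm]
    _ ≤ _ := by
        refine integral_mono_ae ((integrable_const _).indicator hS)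
          (integrable_sq_norm_integral_fourierChar_mul hf ξ₀ _) ?_
        filter_upwards [hSf] with ξ hξ
        by_cases hmem : ξ ∈ S
        · obtain ⟨hfξ, hr⟩ := hξ hmem
          rw [indicator_of_mem hmem]
          calc (1 / 4) * V₀ ^ 2 = ((1 / 2) * V₀) ^ 2 * 1 := by ring
            _ ≤ _ := by gcongr; exact half_volume_ball_le_norm_integral_fourierChar hr
        · rw [indicator_of_notMem hmem]
          exact mul_nonneg (by positivity) (hf0 ξ)

/-- The integrand is tested against the autocorrelation of a ball, modulated to `ξ₀`, whose
Fourier transform is nonnegative and bounded below on `S`. -/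
theorem le_lintegral_ball_densityFourierInv [IsFiniteMeasure μ] (hf0 : 0 ≤ f)
    (hf : Integrable f μ) (ξ₀ : V) (hr : 0 < r) {S : Set V} (hS : MeasurableSet S)
    (hSf : ∀ᵐ ξ ∂μ, ξ ∈ S → 1 ≤ f ξ ∧ r * ‖ξ - ξ₀‖ ≤ 1 / 6) :
    ENNReal.ofReal (1 / 4) * μ S * volume (ball (0 : V) r) ≤
      ∫⁻ x in ball (0 : V) (2 * r), ‖densityFourierInv μ f x‖ₑ := by
  set B := volume (ball (0 : V) r)
  have hB0 : B ≠ 0 := (measure_ball_pos volume _ hr).ne'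
  have hBtop : B ≠ ⊤ := measure_ball_lt_top.ne
  have h := (ENNReal.ofReal_le_ofReal (le_integral_sq_norm_mul hf0 hf ξ₀ hS hSf)).trans
    (ofReal_integral_sq_norm_mul_le_lintegral_ball hf0 hf ξ₀ r)
  rw [ENNReal.ofReal_mul (by positivity), ENNReal.ofReal_mul (by positivity),
    ENNReal.ofReal_pow measureReal_nonneg, ofReal_measureReal hBtop, ofReal_measureReal] at h
  refine (ENNReal.mul_le_mul_iff_right hB0 hBtop).1 (le_trans (le_of_eq ?_) h)
  ring

end Ball

/-! ### The paraboloid and its surface measure -/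

section Paraboloid

variable {n : ℕ}

theorem norm_le_sum_abs {d : ℕ} (x : E d) : ‖x‖ ≤ ∑ i, |x i| := by
  rw [EuclideanSpace.norm_eq]
  refine Real.sqrt_le_iff.2 ⟨Finset.sum_nonneg fun i _ ↦ abs_nonneg _, ?_⟩
  simpa using Finset.sum_sq_le_sq_sum_of_nonneg (s := Finset.univ) (f := fun i ↦ |x i|)
    fun i _ ↦ abs_nonneg _

@[simp]
theorem paraLift_castSucc (ξ : Fin n → ℝ) (i : Fin n) : paraLift ξ i.castSucc = ξ i := by
  simp [paraLift]

@[simp]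
theorem paraLift_last (ξ : Fin n → ℝ) : paraLift ξ (Fin.last n) = ∑ i, ξ i ^ 2 := by
  simp [paraLift]

@[simp]
theorem horiz_paraLift (ξ : Fin n → ℝ) : horiz (paraLift ξ) = ξ := by
  ext i
  simp [horiz]

theorem measurable_paraLift : Measurable (paraLift (n := n)) := by
  refine (WithLp.measurable_toLp 2 _).comp (measurable_pi_lambda _ fun i ↦ ?_)
  refine Fin.lastCases ?_ (fun i ↦ ?_) i
  · simp only [Fin.snoc_last]
    fun_prop
  · simp only [Fin.snoc_castSucc]
    fun_prop

theorem measurable_horiz : Measurable (horiz (n := n)) := by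
  unfold horiz
  fun_prop

theorem measurableSet_paraboloid (n : ℕ) : MeasurableSet (paraboloid n) := by
  have hcoord (i : Fin n) : Measurable fun ξ : E (n + 1) ↦ horiz ξ i :=
    (measurable_pi_apply i).comp measurable_horiz
  refine MeasurableSet.inter (measurableSet_eq_fun (by fun_prop) (by fun_prop)) ?_
  exact measurableSet_setOfPred.2 (Measurable.forall fun i ↦
    measurableSet_setOfPred.1 (measurableSet_le (hcoord i).abs measurable_const))

theorem paraLift_mem_paraboloid {ξ : Fin n → ℝ} (h : ξ ∈ Icc (-1 : Fin n → ℝ) 1) :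
    paraLift ξ ∈ paraboloid n :=
  ⟨by simp, fun i ↦ by simpa using abs_le.2 ⟨h.1 i, h.2 i⟩⟩

theorem sum_sq_le_of_forall_abs_le_one {ξ : Fin n → ℝ} (hξ : ∀ i, |ξ i| ≤ 1) :
    ∑ i, ξ i ^ 2 ≤ n := by
  simpa using Finset.sum_le_card_nsmul Finset.univ (fun i ↦ ξ i ^ 2) 1
    fun i _ ↦ (sq_le_one_iff_abs_le_one _).2 (hξ i)

theorem norm_le_of_mem_paraboloid {ξ : E (n + 1)} (hξ : ξ ∈ paraboloid n) : ‖ξ‖ ≤ 2 * n := by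
  have hhoriz : ∑ i : Fin n, |ξ i.castSucc| ≤ n := by
    simpa using Finset.sum_le_card_nsmul Finset.univ (fun i : Fin n ↦ |ξ i.castSucc|) 1
      fun i _ ↦ hξ.2 i
  refine (norm_le_sum_abs ξ).trans ?_
  rw [Fin.sum_univ_castSucc, hξ.1, abs_of_nonneg (Finset.sum_nonneg fun i _ ↦ sq_nonneg _)]
  linarith [sum_sq_le_of_forall_abs_le_one hξ.2]

theorem norm_sub_paraLift_le {ξ : E (n + 1)} (hξ : ξ ∈ paraboloid n) {c : Fin n → ℝ} {δ : ℝ}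
    (hc : ∀ i, |c i| ≤ 1) (h : ∀ i, |horiz ξ i - c i| ≤ δ) : ‖ξ - paraLift c‖ ≤ 3 * n * δ := by
  have hhoriz : ∑ i : Fin n, |ξ i.castSucc - c i| ≤ n * δ := by
    simpa using Finset.sum_le_card_nsmul Finset.univ (fun i : Fin n ↦ |ξ i.castSucc - c i|) δ
      fun i _ ↦ h i
  have hsq (i : Fin n) : |horiz ξ i ^ 2 - c i ^ 2| ≤ 2 * δ := by
    rw [sq_sub_sq, abs_mul]
    have hadd : |horiz ξ i + c i| ≤ 2 := (abs_add_le _ _).trans (by linarith [hξ.2 i, hc i])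
    exact mul_le_mul hadd (h i) (abs_nonneg _) (by norm_num)
  have hlast : |∑ i : Fin n, (horiz ξ i ^ 2 - c i ^ 2)| ≤ n * (2 * δ) := by
    simpa using (Finset.abs_sum_le_sum_abs _ _).trans
      (Finset.sum_le_card_nsmul Finset.univ _ (2 * δ) fun i _ ↦ hsq i)
  refine (norm_le_sum_abs _).trans ?_
  rw [Fin.sum_univ_castSucc]
  simp only [PiLp.sub_apply, paraLift_castSucc, paraLift_last]
  rw [hξ.1, ← Finset.sum_sub_distrib]
  linarith

theorem ae_mem_paraboloid (n : ℕ) : ∀ᵐ ξ ∂surfaceMeasure n, ξ ∈ paraboloid n := by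
  refine (ae_map_iff (p := (· ∈ paraboloid n)) measurable_paraLift.aemeasurable
    (measurableSet_paraboloid n)).2 ?_
  refine (withDensity_absolutelyContinuous _ _).ae_le ?_
  filter_upwards [ae_restrict_mem measurableSet_Icc] with ξ hξ using paraLift_mem_paraboloid hξ

theorem surfaceMeasure_preimage_horiz {S : Set (Fin n → ℝ)} (hS : MeasurableSet S) :
    surfaceMeasure n (horiz ⁻¹' S) = ∫⁻ ξ in S ∩ Icc (-1 : Fin n → ℝ) 1,
      ENNReal.ofReal (Real.sqrt (1 + 4 * ∑ i, ξ i ^ 2)) := by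
  have hpre : paraLift ⁻¹' (horiz ⁻¹' S) = S := by
    ext ξ
    simp
  rw [surfaceMeasure, Measure.map_apply measurable_paraLift (measurable_horiz hS), hpre,
    withDensity_apply _ hS, Measure.restrict_restrict hS]

theorem volume_le_surfaceMeasure {S : Set (Fin n → ℝ)} (hS : MeasurableSet S) :
    volume (S ∩ Icc (-1 : Fin n → ℝ) 1) ≤ surfaceMeasure n (horiz ⁻¹' S) := by
  rw [surfaceMeasure_preimage_horiz hS, ← setLIntegral_one]
  refine lintegral_mono fun ξ ↦ ENNReal.one_le_ofReal.2 (Real.one_le_sqrt.2 ?_)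
  linarith [Finset.sum_nonneg fun i (_ : i ∈ Finset.univ) ↦ sq_nonneg (ξ i)]

theorem surfaceMeasure_le {S : Set (Fin n → ℝ)} (hS : MeasurableSet S) :
    surfaceMeasure n (horiz ⁻¹' S) ≤
      ENNReal.ofReal (1 + 4 * n) * volume (S ∩ Icc (-1 : Fin n → ℝ) 1) := by
  rw [surfaceMeasure_preimage_horiz hS, ← setLIntegral_const]
  refine setLIntegral_mono' (hS.inter measurableSet_Icc) fun ξ hξ ↦ ENNReal.ofReal_le_ofReal ?_
  have hle := sum_sq_le_of_forall_abs_le_one fun i ↦ abs_le.2 ⟨hξ.2.1 i, hξ.2.2 i⟩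
  have hnonneg : 0 ≤ ∑ i, ξ i ^ 2 := Finset.sum_nonneg fun i _ ↦ sq_nonneg _
  exact Real.sqrt_le_iff.2 ⟨by positivity, by nlinarith [hnonneg]⟩

instance (n : ℕ) : IsFiniteMeasure (surfaceMeasure n) := ⟨by
  have h := surfaceMeasure_le (n := n) MeasurableSet.univ
  simp only [preimage_univ, univ_inter] at h
  exact h.trans_lt (ENNReal.mul_lt_top ENNReal.ofReal_lt_top isCompact_Icc.measure_lt_top)⟩

theorem pow_le_surfaceMeasure_pi_Ioo {u : Fin n → ℝ} {δ : ℝ} (hδ : 0 ≤ δ) (hu : ∀ i, -1 ≤ u i)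
    (hu' : ∀ i, u i + δ ≤ 1) :
    δ ^ n ≤ (surfaceMeasure n).real (horiz ⁻¹' univ.pi fun i ↦ Ioo (u i) (u i + δ)) := by
  have hsub : (univ.pi fun i ↦ Ioo (u i) (u i + δ)) ⊆ Icc (-1 : Fin n → ℝ) 1 := fun ξ hξ ↦
    ⟨fun i ↦ (hu i).trans (hξ i trivial).1.le, fun i ↦ (hξ i trivial).2.le.trans (hu' i)⟩
  have h := volume_le_surfaceMeasure
    (MeasurableSet.univ_pi fun i ↦ measurableSet_Ioo (a := u i) (b := u i + δ))
  rw [inter_eq_left.2 hsub, Real.volume_pi_Ioo] at h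
  simp only [add_sub_cancel_left, Finset.prod_const, Finset.card_univ, Fintype.card_fin,
    ← ENNReal.ofReal_pow hδ] at h
  exact (ENNReal.ofReal_le_iff_le_toReal (measure_ne_top _ _)).1 h

theorem ext_eq_densityFourierInv (f : E (n + 1) → ℝ) :
    ext f = densityFourierInv (surfaceMeasure n) f := by
  ext x
  refine integral_congr_ae (ae_of_all _ fun ξ ↦ ?_)
  simp only [Circle.smul_def, smul_eq_mul, Real.fourierChar_apply]
  congr 2
  push_cast
  ring

end Paraboloid

/-! ### The frequency boxes and the lattice -/

section Frequencies

variable {n : ℕ} {σ R : ℝ} {l : Fin n → ℤ}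

theorem inv_lt_rpow_neg (hσ : σ < 1 / 2) (hR : 1 < R) : R⁻¹ < R ^ (-σ) := by
  rw [← Real.rpow_neg_one]
  exact Real.rpow_lt_rpow_of_exponent_lt hR (by linarith)

theorem rpow_mul_rpow_neg (hR : 0 < R) : R ^ σ * R ^ (-σ) = 1 := by
  rw [← Real.rpow_add hR, add_neg_cancel, Real.rpow_zero]

theorem mem_freqs : l ∈ freqs n σ R ↔ ∀ i, 1 ≤ l i ∧ (l i : ℝ) < R ^ σ := by
  simp [freqs, Int.lt_ceil]

theorem card_freqs_le (hR : 0 < R) : ((freqs n σ R).card : ℝ) ≤ R ^ ((n : ℝ) * σ) := by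
  have hside : (((Finset.Ico (1 : ℤ) ⌈R ^ σ⌉).card : ℕ) : ℝ) ≤ R ^ σ := by
    have hceil := Int.ceil_pos.2 (Real.rpow_pos_of_pos hR σ)
    rw [Int.card_Ico, ← Int.cast_natCast, Int.toNat_of_nonneg (by lia)]
    push_cast
    linarith [Int.ceil_lt_add_one (R ^ σ)]
  rw [freqs, Fintype.card_piFinset_const, mul_comm, Real.rpow_mul hR.le, Real.rpow_natCast]
  push_cast
  gcongr

theorem le_card_freqs (hσ : 0 < σ) (hR : 1 < R) :
    (1 / 2) ^ n * R ^ ((n : ℝ) * σ) ≤ ((freqs n σ R).card : ℝ) := by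
  have hside : 1 / 2 * R ^ σ ≤ (((Finset.Ico (1 : ℤ) ⌈R ^ σ⌉).card : ℕ) : ℝ) := by
    have hceil : (1 : ℤ) < ⌈R ^ σ⌉ := Int.lt_ceil.2 (by exact_mod_cast Real.one_lt_rpow hR hσ)
    have hceil' : (2 : ℝ) ≤ (⌈R ^ σ⌉ : ℝ) := by exact_mod_cast hceil
    rw [Int.card_Ico, ← Int.cast_natCast, Int.toNat_of_nonneg (by lia)]
    push_cast
    linarith [Int.le_ceil (R ^ σ)]
  rw [freqs, Fintype.card_piFinset_const, mul_comm (n : ℝ), Real.rpow_mul (by linarith),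
    Real.rpow_natCast, ← mul_pow]
  push_cast
  gcongr

/-- The centre of the frequency box `Q_l`. -/
def freqCenter (σ R : ℝ) (l : Fin n → ℤ) : Fin n → ℝ := fun i ↦ (l i : ℝ) * R ^ (-σ)

theorem mem_freqBox {ξ : Fin n → ℝ} :
    ξ ∈ freqBox σ R l ↔ ∀ i, |ξ i - freqCenter σ R l i| < R⁻¹ := by
  refine forall_congr' fun i ↦ ?_
  rw [mem_Ioo, abs_lt, freqCenter]
  constructor <;> rintro ⟨_, _⟩ <;> constructor <;> linarith

theorem freqBox_eq_pi : freqBox σ R l =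
    univ.pi fun i ↦ Ioo (freqCenter σ R l i - R⁻¹) (freqCenter σ R l i + R⁻¹) := by
  ext ξ
  simp [freqBox, freqCenter]

theorem measurableSet_freqBox (l : Fin n → ℤ) : MeasurableSet (freqBox σ R l) := by
  rw [freqBox_eq_pi]
  exact MeasurableSet.univ_pi fun i ↦ measurableSet_Ioo

theorem freqCenter_mem_Ioo (hσ : σ < 1 / 2) (hR : 1 < R) (hl : l ∈ freqs n σ R) (i : Fin n) :
    freqCenter σ R l i ∈ Ioo R⁻¹ 1 := by
  obtain ⟨hl₁, hl₂⟩ := mem_freqs.1 hl i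
  have hl₁' : (1 : ℝ) ≤ l i := by exact_mod_cast hl₁
  have hpos : 0 < R ^ (-σ) := Real.rpow_pos_of_pos (by linarith) _
  refine ⟨?_, ?_⟩
  · exact (inv_lt_rpow_neg hσ hR).trans_le (le_mul_of_one_le_left hpos.le hl₁')
  · rw [← rpow_mul_rpow_neg (σ := σ) (zero_lt_one.trans hR), freqCenter]
    gcongr

theorem abs_freqCenter_le_one (hσ : σ < 1 / 2) (hR : 1 < R) (hl : l ∈ freqs n σ R) (i : Fin n) :
    |freqCenter σ R l i| ≤ 1 := by
  have h := freqCenter_mem_Ioo hσ hR hl i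
  have hR0 : 0 < R⁻¹ := by positivity
  exact abs_le.2 ⟨by linarith [h.1], h.2.le⟩

theorem surfaceMeasure_freqBox_le (hR : 0 < R) (l : Fin n → ℤ) :
    (surfaceMeasure n).real (horiz ⁻¹' freqBox σ R l) ≤ (1 + 4 * n) * 2 ^ n * R ^ (-(n : ℝ)) := by
  have hvol : volume (freqBox σ R l) = ENNReal.ofReal ((2 * R⁻¹) ^ n) := by
    rw [freqBox_eq_pi, Real.volume_pi_Ioo, ENNReal.ofReal_pow (by positivity)]
    simp only [add_sub_sub_cancel, ← two_mul, Finset.prod_const, Finset.card_univ,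
      Fintype.card_fin]
  have h := (surfaceMeasure_le (measurableSet_freqBox (σ := σ) (R := R) l)).trans
    (mul_le_mul_right (measure_mono inter_subset_left) _)
  rw [hvol, ← ENNReal.ofReal_mul (by positivity)] at h
  refine (ENNReal.toReal_le_of_le_ofReal (by positivity) h).trans_eq ?_
  rw [Real.rpow_neg hR.le, Real.rpow_natCast, mul_pow, inv_pow, mul_assoc]

theorem le_surfaceMeasure_freqBox (hσ : σ < 1 / 2) (hR : 1 < R) (hl : l ∈ freqs n σ R) :
    R ^ (-(n : ℝ)) ≤ (surfaceMeasure n).real (horiz ⁻¹' freqBox σ R l) := by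
  have hR0 : 0 < R⁻¹ := by positivity
  have hc := freqCenter_mem_Ioo hσ hR hl
  have h := pow_le_surfaceMeasure_pi_Ioo (u := fun i ↦ freqCenter σ R l i - R⁻¹) hR0.le
    (fun i ↦ by linarith [(hc i).1]) (fun i ↦ by linarith [(hc i).2])
  rw [Real.rpow_neg (by linarith), Real.rpow_natCast, ← inv_pow]
  refine h.trans (measureReal_mono (preimage_mono ?_))
  rw [freqBox_eq_pi]
  exact pi_mono fun i _ ↦ Ioo_subset_Ioo_right (by linarith)

/-- The exponents are tuned so that the products of the coordinates are the integers
`m_i l_i` and `m_d |l|²`. -/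
theorem exists_int_inner_lattice (hR : 0 < R) {y : E (n + 1)} (hy : y ∈ lattice n σ R)
    (l : Fin n → ℤ) : ∃ z : ℤ, inner ℝ y (paraLift (freqCenter σ R l)) = z := by
  obtain ⟨m, hm, hm'⟩ := hy
  refine ⟨∑ i : Fin n, m i.castSucc * l i + m (Fin.last n) * ∑ i, l i ^ 2, ?_⟩
  have hsq : R ^ (2 * σ) * (R ^ (-σ)) ^ 2 = 1 := by
    rw [mul_comm 2 σ, Real.rpow_mul hR.le, Real.rpow_two, ← mul_pow, rpow_mul_rpow_neg hR, one_pow]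
  rw [PiLp.inner_apply, Fin.sum_univ_castSucc]
  simp only [paraLift_castSucc, paraLift_last, hm, hm', freqCenter, RCLike.inner_apply,
    conj_trivial]
  push_cast
  congr 1
  · refine Finset.sum_congr rfl fun i _ ↦ ?_
    linear_combination (m i.castSucc * l i : ℝ) * rpow_mul_rpow_neg (σ := σ) hR
  · simp only [mul_pow, ← Finset.sum_mul]
    linear_combination (m (Fin.last n) * ∑ i, (l i : ℝ) ^ 2) * hsq

theorem exists_int_abs_inner_sub_le (hσ : σ < 1 / 2) (hR : 1 < R) {x y : E (n + 1)} {ρ : ℝ}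
    (hy : y ∈ lattice n σ R) (hyR : ‖y‖ ≤ ρ * R) (hx : dist x y ≤ ρ) (hl : l ∈ freqs n σ R)
    {ξ : E (n + 1)} (hξ : ξ ∈ paraboloid n) (hξl : horiz ξ ∈ freqBox σ R l) :
    ∃ z : ℤ, |inner ℝ x ξ - z| ≤ 5 * n * ρ := by
  obtain ⟨z, hz⟩ := exists_int_inner_lattice (zero_lt_one.trans hR) hy l
  refine ⟨z, ?_⟩
  have hdecomp : inner ℝ x ξ - z = inner ℝ (x - y) ξ
      + inner ℝ y (ξ - paraLift (freqCenter σ R l)) := by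
    rw [inner_sub_left, inner_sub_right, hz]
    ring
  have hoff : |inner ℝ (x - y) ξ| ≤ ρ * (2 * n) := by
    refine (abs_real_inner_le_norm _ _).trans ?_
    rw [← dist_eq_norm]
    exact mul_le_mul hx (norm_le_of_mem_paraboloid hξ) (norm_nonneg _) (dist_nonneg.trans hx)
  have hbox : |inner ℝ y (ξ - paraLift (freqCenter σ R l))| ≤ ρ * R * (3 * n * R⁻¹) :=
    (abs_real_inner_le_norm _ _).trans <| mul_le_mul hyR
      (norm_sub_paraLift_le hξ (abs_freqCenter_le_one hσ hR hl)
        fun i ↦ (mem_freqBox.1 hξl i).le) (norm_nonneg _) ((norm_nonneg _).trans hyR)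
  calc |inner ℝ x ξ - z| ≤ ρ * (2 * n) + ρ * R * (3 * n * R⁻¹) :=
        hdecomp ▸ (abs_add_le _ _).trans (add_le_add hoff hbox)
    _ = 5 * n * ρ := by
        field_simp
        ring

end Frequencies

/-! ### The density `h` and constructive interference -/

section Density

variable {n : ℕ} {σ R : ℝ}

theorem hDensity_nonneg : 0 ≤ hDensity n σ R := fun _ ↦
  Finset.sum_nonneg fun _ _ ↦ indicator_nonneg (fun _ _ ↦ zero_le_one) _

theorem hDensity_eq (ξ : E (n + 1)) : hDensity n σ R ξ =
    ∑ l ∈ freqs n σ R, (horiz ⁻¹' freqBox σ R l).indicator (fun _ ↦ (1 : ℝ)) ξ := rfl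

theorem exists_mem_freqBox_of_hDensity_ne_zero {ξ : E (n + 1)} (h : hDensity n σ R ξ ≠ 0) :
    ∃ l ∈ freqs n σ R, horiz ξ ∈ freqBox σ R l := by
  obtain ⟨l, hl, h⟩ := Finset.exists_ne_zero_of_sum_ne_zero h
  exact ⟨l, hl, mem_of_indicator_ne_zero h⟩

theorem one_le_hDensity {l : Fin n → ℤ} (hl : l ∈ freqs n σ R) {ξ : E (n + 1)}
    (h : horiz ξ ∈ freqBox σ R l) : 1 ≤ hDensity n σ R ξ := by
  have hle := Finset.single_le_sum (f := fun l ↦ (freqBox σ R l).indicator (fun _ ↦ (1 : ℝ))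
    (horiz ξ)) (fun l _ ↦ indicator_nonneg (fun _ _ ↦ zero_le_one) _) hl
  simpa only [hDensity, indicator_of_mem h] using hle

theorem integrable_sum_indicator_freqBox (s : Finset (Fin n → ℤ)) :
    Integrable (fun ξ ↦ ∑ l ∈ s, (horiz ⁻¹' freqBox σ R l).indicator (fun _ ↦ (1 : ℝ)) ξ)
      (surfaceMeasure n) :=
  integrable_finsetSum _ fun l _ ↦
    (integrable_const _).indicator (measurable_horiz (measurableSet_freqBox l))

theorem integral_sum_indicator_freqBox (s : Finset (Fin n → ℤ)) :
    ∫ ξ, ∑ l ∈ s, (horiz ⁻¹' freqBox σ R l).indicator (fun _ ↦ (1 : ℝ)) ξ ∂surfaceMeasure n =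
      ∑ l ∈ s, (surfaceMeasure n).real (horiz ⁻¹' freqBox σ R l) := by
  have hmeas (l : Fin n → ℤ) := measurable_horiz (measurableSet_freqBox (σ := σ) (R := R) l)
  rw [integral_finsetSum _ fun l _ ↦ (integrable_const _).indicator (hmeas l)]
  simp only [integral_indicator_const _ (hmeas _), smul_eq_mul, mul_one]

theorem integral_sum_indicator_freqBox_le (hR : 0 < R) (s : Finset (Fin n → ℤ)) :
    ∫ ξ, ∑ l ∈ s, (horiz ⁻¹' freqBox σ R l).indicator (fun _ ↦ (1 : ℝ)) ξ ∂surfaceMeasure n ≤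
      s.card * ((1 + 4 * n) * 2 ^ n * R ^ (-(n : ℝ))) := by
  rw [integral_sum_indicator_freqBox, ← nsmul_eq_mul]
  exact Finset.sum_le_card_nsmul _ _ _ fun l _ ↦ surfaceMeasure_freqBox_le hR l

theorem integrable_hDensity : Integrable (hDensity n σ R) (surfaceMeasure n) :=
  integrable_sum_indicator_freqBox _

theorem rpow_natCast_mul_sub_one (hR : 0 < R) :
    R ^ ((n : ℝ) * (σ - 1)) = R ^ ((n : ℝ) * σ) * R ^ (-(n : ℝ)) := by
  rw [← Real.rpow_add hR, mul_sub_one, sub_eq_add_neg]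

theorem integral_hDensity_le (hR : 0 < R) : ∫ ξ, hDensity n σ R ξ ∂surfaceMeasure n ≤
    (1 + 4 * n) * 2 ^ n * R ^ ((n : ℝ) * (σ - 1)) := by
  rw [rpow_natCast_mul_sub_one hR]
  refine (integral_sum_indicator_freqBox_le hR _).trans ?_
  calc _ ≤ R ^ ((n : ℝ) * σ) * ((1 + 4 * n) * 2 ^ n * R ^ (-(n : ℝ))) := by
        gcongr
        exact card_freqs_le hR
    _ = _ := by ring

theorem le_integral_hDensity (hσ : 0 < σ) (hσ' : σ < 1 / 2) (hR : 1 < R) :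
    (1 / 2) ^ n * R ^ ((n : ℝ) * (σ - 1)) ≤ ∫ ξ, hDensity n σ R ξ ∂surfaceMeasure n := by
  rw [rpow_natCast_mul_sub_one (zero_lt_one.trans hR), ← mul_assoc]
  calc _ ≤ ((freqs n σ R).card : ℝ) * R ^ (-(n : ℝ)) := by
        gcongr
        exact le_card_freqs hσ hR
    _ ≤ ∑ l ∈ freqs n σ R, (surfaceMeasure n).real (horiz ⁻¹' freqBox σ R l) := by
        rw [← nsmul_eq_mul]
        exact Finset.card_nsmul_le_sum _ _ _ fun l hl ↦ le_surfaceMeasure_freqBox hσ' hR hl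
    _ = _ := (integral_sum_indicator_freqBox _).symm

/-- A distance, up to a factor `R` in the position of the lattice point, within which the phases of
`g` stay within a sixth of a turn of their values at the lattice point. -/
def phaseRadius (n : ℕ) : ℝ := (30 * (n + 1) : ℝ)⁻¹

theorem phaseRadius_pos (n : ℕ) : 0 < phaseRadius n := by
  unfold phaseRadius
  positivity

theorem phaseRadius_le (n : ℕ) : phaseRadius n ≤ 1 / 30 := by
  rw [phaseRadius, ← one_div]
  gcongr
  linarith [n.cast_nonneg (α := ℝ)]

theorem five_mul_phaseRadius_le (n : ℕ) : 5 * n * phaseRadius n ≤ 1 / 6 := by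
  rw [phaseRadius, ← div_eq_mul_inv, div_le_iff₀ (by positivity)]
  linarith

theorem half_integral_le_norm_ext {f : E (n + 1) → ℝ} (hf0 : 0 ≤ f)
    (hf : Integrable f (surfaceMeasure n)) (x : E (n + 1)) (t : ℝ)
    (hphase : ∀ ξ ∈ paraboloid n, f ξ ≠ 0 → ∃ z : ℤ, |inner ℝ x ξ - t - z| ≤ 1 / 6) :
    (1 / 2) * ∫ ξ, f ξ ∂surfaceMeasure n ≤ ‖ext f x‖ := by
  rw [ext_eq_densityFourierInv]
  exact half_integral_le_norm_integral_fourierChar_smul (by fun_prop) hf0 hf t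
    ((ae_mem_paraboloid n).mono hphase)

theorem half_integral_le_norm_ext_of_mem_lattice (hσ : σ < 1 / 2) (hR : 1 < R)
    {f : E (n + 1) → ℝ} (hf0 : 0 ≤ f) (hf : Integrable f (surfaceMeasure n))
    (hfh : ∀ ξ, f ξ ≠ 0 → hDensity n σ R ξ ≠ 0) {x y : E (n + 1)} (hy : y ∈ lattice n σ R)
    (hyR : ‖y‖ ≤ phaseRadius n * R) (hx : dist x y ≤ phaseRadius n) :
    (1 / 2) * ∫ ξ, f ξ ∂surfaceMeasure n ≤ ‖ext f x‖ := by
  refine half_integral_le_norm_ext hf0 hf x 0 fun ξ hξ hfξ ↦ ?_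
  obtain ⟨l, hl, hξl⟩ := exists_mem_freqBox_of_hDensity_ne_zero (hfh ξ hfξ)
  obtain ⟨z, hz⟩ := exists_int_abs_inner_sub_le hσ hR hy hyR hx hl hξ hξl
  exact ⟨z, by simpa only [sub_zero] using hz.trans (five_mul_phaseRadius_le n)⟩

end Density

/-! ### Caps -/

section Grid

variable {n : ℕ} {s : ℝ} {a ξ ζ : Fin n → ℝ} {k : Fin n → ℤ}

/-- The index of the cube of the grid that contains a given point. -/
def gridIndex (s : ℝ) (a ξ : Fin n → ℝ) : Fin n → ℤ := fun i ↦ ⌊(ξ i - a i) / s⌋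

theorem mem_gridCube_iff (hs : 0 < s) : ξ ∈ gridCube s a k ↔ gridIndex s a ξ = k := by
  rw [funext_iff]
  refine forall_congr' fun i ↦ ?_
  rw [gridIndex, Int.floor_eq_iff, le_div_iff₀ hs, div_lt_iff₀ hs, mem_Ico]
  constructor <;> rintro ⟨_, _⟩ <;> constructor <;> linarith

theorem abs_sub_lt_of_gridIndex_eq (hs : 0 < s) (h : gridIndex s a ξ = gridIndex s a ζ)
    (i : Fin n) : |ξ i - ζ i| < s := by
  have habs := Int.abs_sub_lt_one_of_floor_eq_floor (congrFun h i)
  rwa [← sub_div, sub_sub_sub_cancel_right, abs_div, abs_of_pos hs, div_lt_one hs] at habs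

theorem exists_Ioo_subset_gridCube (hs : 0 < s) {δ : ℝ} (hδ : 0 ≤ δ) (hδs : δ ≤ s) :
    ∃ u : Fin n → ℝ, (∀ i, u i ∈ Icc (ξ i - δ) (ξ i)) ∧
      (univ.pi fun i ↦ Ioo (u i) (u i + δ)) ⊆ gridCube s a (gridIndex s a ξ) := by
  have hξ := (mem_gridCube_iff hs).2 (rfl : gridIndex s a ξ = _)
  refine ⟨fun i ↦ max (ξ i - δ) (a i + s * gridIndex s a ξ i),
    fun i ↦ ⟨le_max_left _ _, max_le (by linarith) (hξ i).1⟩, fun ζ hζ i ↦ ?_⟩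
  obtain ⟨hlo, hhi⟩ := hζ i trivial
  refine ⟨(le_max_right _ _).trans hlo.le, hhi.trans_le ?_⟩
  rw [← le_sub_iff_add_le]
  exact max_le (by linarith [(hξ i).2]) (by linarith)

theorem measurableSet_cap (k : Fin n → ℤ) : MeasurableSet (cap s a k) := by
  have hcube : gridCube s a k =
      univ.pi fun i ↦ Ico (a i + s * k i) (a i + s * (k i + 1)) := by
    ext ξ
    simp [gridCube]
  have hmeas : MeasurableSet (gridCube s a k) := by
    rw [hcube]
    exact MeasurableSet.univ_pi fun i ↦ measurableSet_Ico
  exact (measurableSet_paraboloid n).inter (measurable_horiz hmeas)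

theorem card_piFinset_Icc_add (u : Fin n → ℤ) (m : ℕ) :
    (Fintype.piFinset fun i ↦ Finset.Icc (u i) (u i + m)).card = (m + 1) ^ n := by
  have hcard (i : Fin n) : (Finset.Icc (u i) (u i + m)).card = m + 1 := by
    rw [Int.card_Icc]
    lia
  simp only [Fintype.card_piFinset, hcard, Finset.prod_const, Finset.card_univ, Fintype.card_fin]

end Grid

section Caps

variable {n : ℕ} {σ R s : ℝ} {a : Fin n → ℝ} {k l : Fin n → ℤ} {ξ : E (n + 1)}

theorem IsCapSide.lt_rpow_neg (hs : IsCapSide R s) (hσ : σ < 1 / 2) (hR : 1 < R) :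
    s < R ^ (-σ) :=
  hs.2.trans_lt (Real.rpow_lt_rpow_of_exponent_lt hR (by linarith))

theorem IsCapSide.half_inv_le (hs : IsCapSide R s) (hR : 1 ≤ R) : R⁻¹ / 2 ≤ s := by
  refine (div_le_div_of_nonneg_right ?_ zero_le_two).trans hs.1
  rw [← Real.rpow_neg_one]
  exact Real.rpow_le_rpow_of_exponent_le hR (by norm_num)

theorem IsCapSide.pos (hs : IsCapSide R s) (hR : 0 < R) : 0 < s :=
  lt_of_lt_of_le (by positivity) hs.1

/-- The density `h 1_θ` of `g_θ`. -/
def capDensity (σ R s : ℝ) (a : Fin n → ℝ) (k : Fin n → ℤ) : E (n + 1) → ℝ :=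
  (cap s a k).indicator (hDensity n σ R)

theorem capPart_hDensity : capPart (hDensity n σ R) s a k = ext (capDensity σ R s a k) := rfl

theorem capDensity_nonneg : 0 ≤ capDensity σ R s a k :=
  indicator_nonneg fun ξ _ ↦ hDensity_nonneg ξ

theorem integrable_capDensity : Integrable (capDensity σ R s a k) (surfaceMeasure n) :=
  integrable_hDensity.indicator (measurableSet_cap k)

theorem capDensity_ne_zero_iff :
    capDensity σ R s a k ξ ≠ 0 ↔ ξ ∈ cap s a k ∧ hDensity n σ R ξ ≠ 0 := by
  simp only [capDensity, ne_eq, indicator_apply_eq_zero, Classical.not_imp]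

theorem exists_capDensity_ne_zero (h : capPart (hDensity n σ R) s a k ≠ 0) :
    ∃ ξ, capDensity σ R s a k ξ ≠ 0 := by
  by_contra! hzero
  refine h (funext fun x ↦ ?_)
  simp [capPart_hDensity, ext, hzero]

open Classical in
/-- The frequency boxes that meet a given cube of the grid. -/
def freqsMeeting (σ R s : ℝ) (a : Fin n → ℝ) (k : Fin n → ℤ) : Finset (Fin n → ℤ) :=
  (freqs n σ R).filter fun l ↦ (gridCube s a k ∩ freqBox σ R l).Nonempty

theorem mem_freqsMeeting : l ∈ freqsMeeting σ R s a k ↔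
    l ∈ freqs n σ R ∧ (gridCube s a k ∩ freqBox σ R l).Nonempty := by
  classical exact Finset.mem_filter

theorem card_freqsMeeting_le (hσ : σ < 1 / 2) (hR : 1 < R) (hs : IsCapSide R s)
    (k : Fin n → ℤ) : (freqsMeeting σ R s a k).card ≤ 3 ^ n := by
  have hpos : 0 < R ^ (-σ) := Real.rpow_pos_of_pos (by linarith) _
  refine (Finset.card_le_card fun l hl ↦ Fintype.mem_piFinset.2 fun i ↦ ?_).trans_eq
    (card_piFinset_Icc_add (fun i ↦ ⌊(a i + s * k i) / R ^ (-σ)⌋) 2)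
  obtain ⟨-, ξ, hξk, hξl⟩ := mem_freqsMeeting.1 hl
  obtain ⟨hlo, hhi⟩ := hξk i
  obtain ⟨hlo', hhi'⟩ := hξl i
  have hside := hs.lt_rpow_neg hσ hR
  have hinv := inv_lt_rpow_neg hσ hR
  rw [Finset.mem_Icc, Int.floor_le_iff, ← sub_le_iff_le_add, Int.le_floor, div_lt_iff₀ hpos,
    le_div_iff₀ hpos]
  push_cast
  constructor <;> linarith

theorem capDensity_le_sum_indicator (ξ : E (n + 1)) : capDensity σ R s a k ξ ≤
    ∑ l ∈ freqsMeeting σ R s a k, (horiz ⁻¹' freqBox σ R l).indicator (fun _ ↦ (1 : ℝ)) ξ := by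
  refine indicator_apply_le' (fun hξ ↦ ?_) fun _ ↦
    Finset.sum_nonneg fun l _ ↦ indicator_nonneg (fun _ _ ↦ zero_le_one) _
  rw [hDensity_eq]
  refine (Finset.sum_subset (fun l hl ↦ (mem_freqsMeeting.1 hl).1) fun l hl hl' ↦
    indicator_of_notMem (fun hξl ↦ ?_) _).ge
  exact hl' (mem_freqsMeeting.2 ⟨hl, horiz ξ, hξ.2, hξl⟩)

/-- A bound for the numbers `R^(d-1) ‖g_θ‖_∞`: the number of frequency boxes that can meet a cap,
times the bound for the measure of a box. -/
def capBound (n : ℕ) : ℝ := 3 ^ n * ((1 + 4 * n) * 2 ^ n)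

theorem capBound_pos (n : ℕ) : 0 < capBound n := by
  rw [capBound]
  positivity

theorem integral_capDensity_le (hσ : σ < 1 / 2) (hR : 1 < R) (hs : IsCapSide R s) :
    ∫ ξ, capDensity σ R s a k ξ ∂surfaceMeasure n ≤ capBound n * R ^ (-(n : ℝ)) := by
  calc ∫ ξ, capDensity σ R s a k ξ ∂surfaceMeasure n
      ≤ (freqsMeeting σ R s a k).card * ((1 + 4 * n) * 2 ^ n * R ^ (-(n : ℝ))) :=
        (integral_mono integrable_capDensity (integrable_sum_indicator_freqBox _)
          capDensity_le_sum_indicator).trans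
          (integral_sum_indicator_freqBox_le (zero_lt_one.trans hR) _)
    _ ≤ 3 ^ n * ((1 + 4 * n) * 2 ^ n * R ^ (-(n : ℝ))) := by
        gcongr
        exact_mod_cast card_freqsMeeting_le hσ hR hs k
    _ = capBound n * R ^ (-(n : ℝ)) := by
        rw [capBound]
        ring

theorem norm_capPart_le (hσ : σ < 1 / 2) (hR : 1 < R) (hs : IsCapSide R s) (x : E (n + 1)) :
    ‖capPart (hDensity n σ R) s a k x‖ ≤ capBound n * R ^ (-(n : ℝ)) := by
  rw [capPart_hDensity, ext_eq_densityFourierInv]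
  exact (norm_densityFourierInv_le capDensity_nonneg x).trans (integral_capDensity_le hσ hR hs)

/-- The index of a cube of the grid that contains a large part of `Q_l ∩ [-1,1]^(d-1)`. -/
def capIndex (σ R s : ℝ) (a : Fin n → ℝ) (l : Fin n → ℤ) : Fin n → ℤ :=
  gridIndex s a fun i ↦ freqCenter σ R l i - R⁻¹ / 4

theorem capIndex_injective (hσ : σ < 1 / 2) (hR : 1 < R) (hs : IsCapSide R s) :
    Function.Injective (capIndex σ R s a) := by
  intro l l' h
  ext i
  have hpos : 0 < R ^ (-σ) := Real.rpow_pos_of_pos (by linarith) _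
  have hlt := (abs_sub_lt_of_gridIndex_eq (hs.pos (by linarith)) h i).trans
    (hs.lt_rpow_neg hσ hR)
  rw [sub_sub_sub_cancel_right, freqCenter, freqCenter, ← sub_mul, abs_mul, abs_of_pos hpos,
    mul_lt_iff_lt_one_left hpos] at hlt
  have hlt' : |l i - l' i| < 1 := by exact_mod_cast hlt
  exact sub_eq_zero.1 (Int.abs_lt_one_iff.1 hlt')

theorem exists_subset_cap (hσ : σ < 1 / 2) (hR : 1 < R) (hs : IsCapSide R s)
    (hl : l ∈ freqs n σ R) : ∃ S : Set (E (n + 1)), MeasurableSet S ∧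
      (1 / 4) ^ n * R ^ (-(n : ℝ)) ≤ (surfaceMeasure n).real S ∧
      (∀ ξ ∈ S, horiz ξ ∈ freqBox σ R l) ∧
      ∀ ξ ∈ S, ξ ∈ paraboloid n → 1 ≤ capDensity σ R s a (capIndex σ R s a l) ξ := by
  have hR0 : 0 < R⁻¹ := by positivity
  have hc := freqCenter_mem_Ioo hσ hR hl
  obtain ⟨u, hu, husub⟩ := exists_Ioo_subset_gridCube (a := a)
    (ξ := fun i ↦ freqCenter σ R l i - R⁻¹ / 4) (δ := R⁻¹ / 4) (hs.pos (by linarith))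
    (by positivity) (by linarith [hs.half_inv_le hR.le])
  have hbox : ∀ ξ ∈ univ.pi fun i ↦ Ioo (u i) (u i + R⁻¹ / 4), ξ ∈ freqBox σ R l := fun ξ hξ ↦
    mem_freqBox.2 fun i ↦ abs_lt.2 ⟨by linarith [(hu i).1, (hξ i trivial).1],
      by linarith [(hu i).2, (hξ i trivial).2]⟩
  refine ⟨horiz ⁻¹' univ.pi fun i ↦ Ioo (u i) (u i + R⁻¹ / 4),
    measurable_horiz (MeasurableSet.univ_pi fun i ↦ measurableSet_Ioo), ?_,
    fun ξ hξ ↦ hbox _ hξ, fun ξ hξ hp ↦ ?_⟩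
  · refine le_trans (le_of_eq ?_) (pow_le_surfaceMeasure_pi_Ioo (by positivity)
      (fun i ↦ by linarith [(hu i).1, (hc i).1]) (fun i ↦ by linarith [(hu i).2, (hc i).2]))
    rw [Real.rpow_neg (by linarith), Real.rpow_natCast, ← inv_pow, ← mul_pow, one_div,
      inv_mul_eq_div]
  · rw [capDensity, indicator_of_mem (show ξ ∈ cap s a (capIndex σ R s a l) from ⟨hp, husub hξ⟩)]
    exact one_le_hDensity hl (hbox _ hξ)

theorem le_integral_capDensity (hσ : σ < 1 / 2) (hR : 1 < R) (hs : IsCapSide R s)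
    (hl : l ∈ freqs n σ R) : (1 / 4) ^ n * R ^ (-(n : ℝ)) ≤
      ∫ ξ, capDensity σ R s a (capIndex σ R s a l) ξ ∂surfaceMeasure n := by
  obtain ⟨S, hS, hSmeas, -, hSle⟩ := exists_subset_cap (a := a) hσ hR hs hl
  refine hSmeas.trans ?_
  rw [← integral_indicator_one hS]
  refine integral_mono_ae ((integrable_const _).indicator hS) integrable_capDensity ?_
  filter_upwards [ae_mem_paraboloid n] with ξ hξ
  exact indicator_apply_le' (fun hm ↦ hSle ξ hm hξ) fun _ ↦ capDensity_nonneg ξ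

theorem le_norm_capPart_of_mem_lattice (hσ : σ < 1 / 2) (hR : 1 < R) (hs : IsCapSide R s)
    (hl : l ∈ freqs n σ R) {y : E (n + 1)} (hy : y ∈ lattice n σ R)
    (hyR : ‖y‖ ≤ phaseRadius n * R) : (1 / 2) * ((1 / 4) ^ n * R ^ (-(n : ℝ))) ≤
      ‖capPart (hDensity n σ R) s a (capIndex σ R s a l) y‖ := by
  refine le_trans ?_ (half_integral_le_norm_ext_of_mem_lattice hσ hR capDensity_nonneg
    integrable_capDensity (fun ξ h ↦ (capDensity_ne_zero_iff.1 h).2) hy hyR (x := y)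
    ((dist_self y).trans_le (phaseRadius_pos n).le))
  gcongr
  exact le_integral_capDensity hσ hR hs hl

/-- A finite set of indices that contains those of all the caps in which `g` has frequencies: a
cube that meets `Q_l` has an index within `4` steps of that of the corner of `Q_l`. -/
def activeCaps (σ R s : ℝ) (a : Fin n → ℝ) : Finset (Fin n → ℤ) :=
  (freqs n σ R).biUnion fun l ↦ Fintype.piFinset fun i ↦
    Finset.Icc (gridIndex s a (fun i ↦ freqCenter σ R l i - R⁻¹) i)
      (gridIndex s a (fun i ↦ freqCenter σ R l i - R⁻¹) i + 4)

theorem card_activeCaps_le (hR : 0 < R) :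
    ((activeCaps σ R s a).card : ℝ) ≤ 5 ^ n * R ^ ((n : ℝ) * σ) := by
  have hcard : (activeCaps σ R s a).card ≤ (freqs n σ R).card * 5 ^ n :=
    Finset.card_biUnion_le_card_mul _ _ _ fun l _ ↦ (card_piFinset_Icc_add _ 4).le
  calc ((activeCaps σ R s a).card : ℝ) ≤ (freqs n σ R).card * 5 ^ n := by exact_mod_cast hcard
    _ ≤ R ^ ((n : ℝ) * σ) * 5 ^ n := by
        gcongr
        exact card_freqs_le hR
    _ = _ := mul_comm _ _

theorem mem_activeCaps (hR : 1 ≤ R) (hs : IsCapSide R s) (h : capDensity σ R s a k ξ ≠ 0) :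
    k ∈ activeCaps σ R s a := by
  obtain ⟨⟨-, hk⟩, hh⟩ := capDensity_ne_zero_iff.1 h
  obtain ⟨l, hl, hξl⟩ := exists_mem_freqBox_of_hDensity_ne_zero hh
  have hs0 := hs.pos (by linarith)
  rw [mem_gridCube_iff hs0] at hk
  refine Finset.mem_biUnion.2 ⟨l, hl, Fintype.mem_piFinset.2 fun i ↦ ?_⟩
  obtain ⟨hlo, hhi⟩ := abs_lt.1 (mem_freqBox.1 hξl i)
  rw [← hk, gridIndex, gridIndex, Finset.mem_Icc]
  refine ⟨Int.floor_le_floor (div_le_div_of_nonneg_right (by linarith) hs0.le), ?_⟩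
  rw [← Int.floor_add_ofNat]
  refine Int.floor_le_floor ?_
  rw [div_add' _ _ _ hs0.ne']
  exact div_le_div_of_nonneg_right (by linarith [hs.half_inv_le hR]) hs0.le

theorem capPart_eq_zero (hR : 1 ≤ R) (hs : IsCapSide R s) (hk : k ∉ activeCaps σ R s a) :
    capPart (hDensity n σ R) s a k = 0 := by
  by_contra h
  obtain ⟨ξ, hξ⟩ := exists_capDensity_ne_zero h
  exact hk (mem_activeCaps hR hs hξ)

end Caps

section Adapted

variable {n : ℕ} {σ R s : ℝ} {a : Fin n → ℝ} {k l : Fin n → ℤ} {ξ : E (n + 1)}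

theorem IsAdapted.capIndex_eq (had : IsAdapted n σ R s a) (hσ : σ < 1 / 2) (hR : 1 < R)
    (hs : IsCapSide R s) (hl : l ∈ freqs n σ R) (hξ : ξ ∈ cap s a k)
    (hξl : horiz ξ ∈ freqBox σ R l) : capIndex σ R s a l = k := by
  have hs0 := hs.pos (by linarith)
  have hR0 : 0 < R⁻¹ := by positivity
  have hc := freqCenter_mem_Ioo hσ hR hl
  obtain ⟨k', hk'⟩ := had l hl
  have hξk' : horiz ξ ∈ gridCube s a k' :=
    hk' ⟨hξl, fun i ↦ (abs_le.1 (hξ.1.2 i)).1, fun i ↦ (abs_le.1 (hξ.1.2 i)).2⟩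
  have hck' : (fun i ↦ freqCenter σ R l i - R⁻¹ / 4) ∈ gridCube s a k' := by
    refine hk' ⟨mem_freqBox.2 fun i ↦ abs_lt.2 ⟨by linarith, by linarith⟩, fun i ↦ ?_, fun i ↦ ?_⟩
    · linarith [(hc i).1, show (-1 : Fin n → ℝ) i = -1 from rfl]
    · linarith [(hc i).2, show (1 : Fin n → ℝ) i = 1 from rfl]
  rw [mem_gridCube_iff hs0] at hξk' hck'
  rw [capIndex, hck', ← hξk', (mem_gridCube_iff hs0).1 hξ.2]

theorem IsAdapted.exists_freq (had : IsAdapted n σ R s a) (hσ : σ < 1 / 2) (hR : 1 < R)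
    (hs : IsCapSide R s) (hk : capPart (hDensity n σ R) s a k ≠ 0) :
    ∃ l ∈ freqs n σ R, capIndex σ R s a l = k ∧
      ∀ ξ, capDensity σ R s a k ξ ≠ 0 → horiz ξ ∈ freqBox σ R l := by
  have hfreq (ξ) (hξ : capDensity σ R s a k ξ ≠ 0) :
      ∃ l ∈ freqs n σ R, capIndex σ R s a l = k ∧ horiz ξ ∈ freqBox σ R l := by
    obtain ⟨hξk, hh⟩ := capDensity_ne_zero_iff.1 hξ
    obtain ⟨l, hl, hξl⟩ := exists_mem_freqBox_of_hDensity_ne_zero hh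
    exact ⟨l, hl, had.capIndex_eq hσ hR hs hl hξk hξl, hξl⟩
  obtain ⟨ξ, hξ⟩ := exists_capDensity_ne_zero hk
  obtain ⟨l, hl, hlk, -⟩ := hfreq ξ hξ
  refine ⟨l, hl, hlk, fun ζ hζ ↦ ?_⟩
  obtain ⟨l', -, hl'k, hζl'⟩ := hfreq ζ hζ
  rwa [capIndex_injective hσ hR hs (hlk.trans hl'k.symm)]

theorem IsAdapted.le_norm_capPart (had : IsAdapted n σ R s a) (hσ : σ < 1 / 2) (hR : 1 < R)
    (hs : IsCapSide R s) (hk : capPart (hDensity n σ R) s a k ≠ 0) {x : E (n + 1)}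
    (hx : ‖x‖ ≤ phaseRadius n * R) :
    (1 / 2) * ((1 / 4) ^ n * R ^ (-(n : ℝ))) ≤ ‖capPart (hDensity n σ R) s a k x‖ := by
  obtain ⟨l, hl, rfl, hfreq⟩ := had.exists_freq hσ hR hs hk
  refine le_trans ?_ (half_integral_le_norm_ext capDensity_nonneg integrable_capDensity x
    (inner ℝ x (paraLift (freqCenter σ R l))) fun ξ hξ hξ0 ↦ ⟨0, ?_⟩)
  · gcongr
    exact le_integral_capDensity hσ hR hs hl
  · rw [Int.cast_zero, sub_zero, ← inner_sub_right]
    have hdist := norm_sub_paraLift_le hξ (abs_freqCenter_le_one hσ hR hl)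
      fun i ↦ (mem_freqBox.1 (hfreq ξ hξ0) i).le
    calc |inner ℝ x (ξ - paraLift (freqCenter σ R l))|
        ≤ phaseRadius n * R * (3 * n * R⁻¹) :=
          (abs_real_inner_le_norm _ _).trans
            (mul_le_mul hx hdist (norm_nonneg _) ((norm_nonneg _).trans hx))
      _ = 3 * n * phaseRadius n := by field_simp
      _ ≤ 5 * n * phaseRadius n := by
          have := (phaseRadius_pos n).le
          gcongr
          norm_num
      _ ≤ 1 / 6 := five_mul_phaseRadius_le n

theorem IsCapSide.two_mul_inv_le (hs : IsCapSide R s) (hR : 16 ≤ R) : 2 * R⁻¹ ≤ s := by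
  have hpos : 0 < R ^ (-(1 / 2 : ℝ)) := Real.rpow_pos_of_pos (by linarith) _
  have hsq : R⁻¹ = R ^ (-(1 / 2 : ℝ)) * R ^ (-(1 / 2 : ℝ)) := by
    rw [← Real.rpow_add (by linarith), ← Real.rpow_neg_one]
    norm_num
  have hinv : R⁻¹ ≤ 1 / 16 := by
    rw [one_div]
    exact inv_anti₀ (by norm_num) hR
  have hquarter : R ^ (-(1 / 2 : ℝ)) ≤ 1 / 4 := by nlinarith
  calc 2 * R⁻¹ ≤ R ^ (-(1 / 2 : ℝ)) / 2 := by nlinarith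
    _ ≤ s := hs.1

theorem exists_isCapSide_rpow_neg_div (hσ : σ < 1 / 2) (hR : 1 < R) :
    ∃ M : ℤ, 0 < M ∧ IsCapSide R (R ^ (-σ) / M) := by
  have hb : 1 < R ^ (1 / 2 - σ) := Real.one_lt_rpow hR (by linarith)
  have hM : (0 : ℝ) < ⌈R ^ (1 / 2 - σ)⌉ := by linarith [Int.le_ceil (R ^ (1 / 2 - σ))]
  have hpos : 0 < R ^ (-(1 / 2 : ℝ)) := Real.rpow_pos_of_pos (by linarith) _
  have hsplit : R ^ (-σ) = R ^ (-(1 / 2 : ℝ)) * R ^ (1 / 2 - σ) := by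
    rw [← Real.rpow_add (by linarith)]
    ring_nf
  refine ⟨⌈R ^ (1 / 2 - σ)⌉, by exact_mod_cast hM, ?_, ?_⟩
  · rw [le_div_iff₀ hM, hsplit]
    nlinarith [Int.ceil_lt_add_one (R ^ (1 / 2 - σ))]
  · rw [div_le_iff₀ hM, hsplit]
    gcongr
    exact Int.le_ceil _

/-- Refine the grid of cubes centred at `R^{-σ} ℤ^(d-1)`: as `s` divides `R^{-σ}`, every `Q_l`
keeps its centre at the centre of a cube. -/
theorem exists_isAdapted (hσ : σ < 1 / 2) (hR : 16 ≤ R) :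
    ∃ (s : ℝ) (a : Fin n → ℝ), IsCapSide R s ∧ IsAdapted n σ R s a := by
  obtain ⟨M, hM, hs⟩ := exists_isCapSide_rpow_neg_div hσ (by linarith)
  refine ⟨R ^ (-σ) / M, fun _ ↦ -(R ^ (-σ) / M / 2), hs, fun l _ ↦ ⟨fun i ↦ M * l i, ?_⟩⟩
  rintro ξ ⟨hξ, -⟩ i
  obtain ⟨hlo, hhi⟩ := hξ i
  have hside := hs.two_mul_inv_le hR
  have hcorner : R ^ (-σ) / M * ((M * l i : ℤ) : ℝ) = l i * R ^ (-σ) := by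
    have hM0 : (M : ℝ) ≠ 0 := by exact_mod_cast hM.ne'
    push_cast
    field_simp
  constructor
  · rw [hcorner]
    linarith
  · rw [mul_add_one, hcorner]
    linarith

end Adapted

/-! ### Norms of functions bounded above or below -/

section LpNorm

variable {α F : Type*} [MeasurableSpace α] {μ : Measure α} [NormedAddCommGroup F] {f : α → F}
  {p b v : ℝ} {S : Set α}

theorem eLpNorm_le_of_norm_le_of_measure_univ_le (hp : 0 < p) (hb : ∀ x, ‖f x‖ ≤ b) (hv0 : 0 ≤ v)
    (hv : μ univ ≤ ENNReal.ofReal v) :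
    eLpNorm f (ENNReal.ofReal p) μ ≤ ENNReal.ofReal (b * v ^ p⁻¹) := by
  refine (eLpNorm_le_of_ae_bound (ae_of_all _ hb)).trans ?_
  rw [ENNReal.toReal_ofReal hp.le, ENNReal.ofReal_mul' (by positivity), mul_comm,
    ← ENNReal.ofReal_rpow_of_nonneg hv0 (by positivity)]
  gcongr

theorem le_eLpNorm_of_le_norm_of_le_measure (hp : 0 < p) (hS : MeasurableSet S)
    (hb : ∀ x ∈ S, b ≤ ‖f x‖) (hv0 : 0 ≤ v) (hv : ENNReal.ofReal v ≤ μ S) :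
    ENNReal.ofReal (b * v ^ p⁻¹) ≤ eLpNorm f (ENNReal.ofReal p) μ := by
  refine le_trans ?_ (le_eLpNorm_of_bddBelow (ENNReal.ofReal_pos.2 hp).ne' ENNReal.ofReal_ne_top
    b.toNNReal hS (ae_of_all _ fun x hx ↦ Real.toNNReal_le_iff_le_coe.2 (hb x hx)))
  rw [ENNReal.toReal_ofReal hp.le, ENNReal.ofReal_mul' (by positivity), one_div,
    ← ENNReal.ofReal_rpow_of_nonneg hv0 (by positivity)]
  exact mul_le_mul_right (ENNReal.rpow_le_rpow hv (by positivity)) _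

theorem mul_rpow_measure_univ_le_eLpNorm [IsFiniteMeasure μ] (hμ : μ ≠ 0) (hp : 1 ≤ p)
    (hf : AEStronglyMeasurable f μ) {m : ℝ≥0∞} (h : m * μ univ ≤ ∫⁻ x, ‖f x‖ₑ ∂μ) :
    m * μ univ ^ p⁻¹ ≤ eLpNorm f (ENNReal.ofReal p) μ := by
  have hμ0 : μ univ ≠ 0 := Measure.measure_univ_ne_zero.2 hμ
  have hμt : μ univ ≠ ∞ := measure_ne_top μ univ
  have hholder : m * μ univ ≤ eLpNorm f (ENNReal.ofReal p) μ * μ univ ^ (1 - p⁻¹) := by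
    rw [← eLpNorm_one_eq_lintegral_enorm] at h
    refine h.trans ((eLpNorm_le_eLpNorm_mul_rpow_measure_univ (ENNReal.one_le_ofReal.2 hp)
      hf).trans_eq ?_)
    rw [ENNReal.toReal_one, ENNReal.toReal_ofReal (by linarith), one_div_one, one_div]
  refine (ENNReal.mul_le_mul_iff_left (c := μ univ ^ (1 - p⁻¹)) (by simp [hμ0, hμt])
    (by simp [hμ0, hμt])).1 ?_
  rwa [mul_assoc, ← ENNReal.rpow_add _ _ hμ0 hμt, add_sub_cancel, ENNReal.rpow_one]

end LpNorm

section Exponents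

variable {n : ℕ} {σ R : ℝ}

theorem two_lt_pCrit (hn : 1 ≤ n) : 2 < pCrit n := by
  have hn0 : (0 : ℝ) < n := by exact_mod_cast hn
  rw [pCrit, lt_div_iff₀ (by push_cast; linarith)]
  push_cast
  linarith

theorem pCrit_pos (hn : 1 ≤ n) : 0 < pCrit n := two_pos.trans (two_lt_pCrit hn)

theorem inv_pCrit (n : ℕ) : (pCrit n)⁻¹ = n / (2 * (n + 2)) := by
  rw [pCrit, inv_div]
  push_cast
  ring

theorem sharpExp_eq (n : ℕ) (σ : ℝ) :
    sharpExp n σ = n / 2 * σ - n * (n + 3) / (2 * (n + 2)) := by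
  rw [sharpExp]
  push_cast
  ring

theorem rpow_mul_rpow_inv_pCrit (hR : 0 < R) :
    R ^ ((n : ℝ) * (σ - 1)) * (R ^ (((n : ℝ) + 1) - ((n : ℝ) + 2) * σ)) ^ (pCrit n)⁻¹ =
      R ^ sharpExp n σ := by
  rw [← Real.rpow_mul hR.le, ← Real.rpow_add hR, sharpExp_eq, inv_pCrit]
  congr 1
  field_simp
  ring

end Exponents

/-! ### Lattice points -/

section IntBox

variable {d : ℕ} {b : Fin d → ℝ} {m : Fin d → ℤ}

/-- The integer points of the box `∏ [-b_i, b_i]`. -/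
def intBox (b : Fin d → ℝ) : Finset (Fin d → ℤ) :=
  Fintype.piFinset fun i ↦ Finset.Icc (-⌊b i⌋) ⌊b i⌋

theorem mem_intBox : m ∈ intBox b ↔ ∀ i, |(m i : ℝ)| ≤ b i := by
  rw [intBox, Fintype.mem_piFinset]
  refine forall_congr' fun i ↦ ?_
  rw [Finset.mem_Icc, ← abs_le, Int.le_floor, Int.cast_abs]

theorem card_intBox (hb : ∀ i, 0 ≤ b i) :
    ((intBox b).card : ℝ) = ∏ i, (2 * (⌊b i⌋ : ℝ) + 1) := by
  rw [intBox, Fintype.card_piFinset, Nat.cast_prod]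
  refine Finset.prod_congr rfl fun i _ ↦ ?_
  have hfloor := Int.floor_nonneg.2 (hb i)
  rw [Int.card_Icc, ← Int.cast_natCast, Int.toNat_of_nonneg (by lia)]
  push_cast
  ring

theorem prod_le_card_intBox (hb : ∀ i, 0 ≤ b i) : ∏ i, b i ≤ ((intBox b).card : ℝ) := by
  rw [card_intBox hb]
  refine Finset.prod_le_prod (fun i _ ↦ hb i) fun i _ ↦ ?_
  have hfloor : (0 : ℝ) ≤ ⌊b i⌋ := by exact_mod_cast Int.floor_nonneg.2 (hb i)
  linarith [Int.lt_floor_add_one (b i)]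

theorem card_intBox_le (hb : ∀ i, 0 ≤ b i) :
    ((intBox b).card : ℝ) ≤ ∏ i, (2 * b i + 1) := by
  rw [card_intBox hb]
  refine Finset.prod_le_prod (fun i _ ↦ ?_) fun i _ ↦ by linarith [Int.floor_le (b i)]
  have hfloor : (0 : ℝ) ≤ ⌊b i⌋ := by exact_mod_cast Int.floor_nonneg.2 (hb i)
  linarith

end IntBox

section Lattice

variable {n : ℕ} {σ R ρ : ℝ} {m : Fin (n + 1) → ℤ} {x y : E (n + 1)}

/-- The spacing of the lattice in the coordinate directions. -/
def latticeScale (n : ℕ) (σ R : ℝ) (i : Fin (n + 1)) : ℝ :=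
  if i = Fin.last n then R ^ (2 * σ) else R ^ σ

theorem latticeScale_pos (hR : 0 < R) (i : Fin (n + 1)) : 0 < latticeScale n σ R i := by
  unfold latticeScale
  split_ifs <;> positivity

theorem one_lt_latticeScale (hσ : 0 < σ) (hR : 1 < R) (i : Fin (n + 1)) :
    1 < latticeScale n σ R i := by
  unfold latticeScale
  split_ifs <;> exact Real.one_lt_rpow hR (by linarith)

theorem latticeScale_le (hσ : σ ≤ 1 / 2) (hR : 1 ≤ R) (i : Fin (n + 1)) :
    latticeScale n σ R i ≤ R := by
  unfold latticeScale
  conv_rhs => rw [← Real.rpow_one R]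
  split_ifs <;> exact Real.rpow_le_rpow_of_exponent_le hR (by linarith)

theorem prod_mul_div_latticeScale (hR : 0 < R) (c : ℝ) :
    ∏ i, c * R / latticeScale n σ R i =
      c ^ (n + 1) * R ^ (((n : ℝ) + 1) - ((n : ℝ) + 2) * σ) := by
  have hscale : ∏ i, latticeScale n σ R i = R ^ (((n : ℝ) + 2) * σ) := by
    simp only [Fin.prod_univ_castSucc, latticeScale, Fin.castSucc_ne_last, if_false, if_true,
      Finset.prod_const, Finset.card_univ, Fintype.card_fin]
    rw [← Real.rpow_natCast, ← Real.rpow_mul hR.le, ← Real.rpow_add hR]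
    ring_nf
  rw [Finset.prod_div_distrib, hscale, Real.rpow_sub hR, Finset.prod_const, Finset.card_univ,
    Fintype.card_fin, mul_pow, mul_div_assoc, ← Nat.cast_add_one, Real.rpow_natCast]

/-- The lattice point with integer coordinates `m`. -/
def latticePoint (σ R : ℝ) (m : Fin (n + 1) → ℤ) : E (n + 1) :=
  WithLp.toLp 2 fun i ↦ (m i : ℝ) * latticeScale n σ R i

theorem latticePoint_apply (m : Fin (n + 1) → ℤ) (i : Fin (n + 1)) :
    latticePoint σ R m i = m i * latticeScale n σ R i := rfl

theorem latticePoint_mem (m : Fin (n + 1) → ℤ) : latticePoint σ R m ∈ lattice n σ R :=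
  ⟨m, fun i ↦ by simp [latticePoint_apply, latticeScale],
    by simp [latticePoint_apply, latticeScale]⟩

theorem exists_latticePoint_eq (hy : y ∈ lattice n σ R) : ∃ m, latticePoint σ R m = y := by
  obtain ⟨m, hm, hm'⟩ := hy
  refine ⟨m, ?_⟩
  ext i
  refine Fin.lastCases ?_ (fun i ↦ ?_) i
  · simp [latticePoint_apply, latticeScale, hm']
  · simp [latticePoint_apply, latticeScale, hm]

theorem one_le_dist_latticePoint (hσ : 0 < σ) (hR : 1 < R) {m' : Fin (n + 1) → ℤ} (h : m ≠ m') :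
    1 ≤ dist (latticePoint σ R m) (latticePoint σ R m') := by
  obtain ⟨i, hi⟩ := Function.ne_iff.1 h
  have hint : (1 : ℝ) ≤ |(m i : ℝ) - m' i| := by
    exact_mod_cast Int.one_le_abs (sub_ne_zero.2 hi)
  calc (1 : ℝ) ≤ |(m i : ℝ) - m' i| * latticeScale n σ R i :=
        one_le_mul_of_one_le_of_one_le hint (one_lt_latticeScale hσ hR i).le
    _ = ‖(latticePoint σ R m - latticePoint σ R m') i‖ := by
        rw [PiLp.sub_apply, latticePoint_apply, latticePoint_apply, ← sub_mul, Real.norm_eq_abs,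
          abs_mul, abs_of_pos (latticeScale_pos (zero_lt_one.trans hR) i)]
    _ ≤ dist (latticePoint σ R m) (latticePoint σ R m') :=
        (PiLp.norm_apply_le _ i).trans_eq (dist_eq_norm _ _).symm

/-- The integer coordinates of the points of the lattice in the cube `[-ρ, ρ]^d`. -/
def latticeBox (n : ℕ) (σ R ρ : ℝ) : Finset (Fin (n + 1) → ℤ) :=
  intBox fun i ↦ ρ / latticeScale n σ R i

theorem mem_latticeBox (hR : 0 < R) :
    m ∈ latticeBox n σ R ρ ↔ ∀ i, |latticePoint σ R m i| ≤ ρ := by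
  rw [latticeBox, mem_intBox]
  refine forall_congr' fun i ↦ ?_
  have hpos := latticeScale_pos (n := n) (σ := σ) hR i
  rw [le_div_iff₀ hpos, latticePoint_apply, abs_mul, abs_of_pos hpos]

theorem le_card_latticeBox (hR : 0 < R) {c : ℝ} (hc : 0 ≤ c) :
    c ^ (n + 1) * R ^ (((n : ℝ) + 1) - ((n : ℝ) + 2) * σ) ≤
      ((latticeBox n σ R (c * R)).card : ℝ) := by
  rw [← prod_mul_div_latticeScale hR]
  refine prod_le_card_intBox fun i ↦ ?_
  have := latticeScale_pos (n := n) (σ := σ) hR i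
  positivity

theorem card_latticeBox_two_mul_le (hσ : σ ≤ 1 / 2) (hR : 1 ≤ R) :
    ((latticeBox n σ R (2 * R)).card : ℝ) ≤
      5 ^ (n + 1) * R ^ (((n : ℝ) + 1) - ((n : ℝ) + 2) * σ) := by
  have hR0 : 0 < R := zero_lt_one.trans_le hR
  have hone (i : Fin (n + 1)) : 1 ≤ R / latticeScale n σ R i :=
    (one_le_div (latticeScale_pos hR0 i)).2 (latticeScale_le hσ hR i)
  rw [← prod_mul_div_latticeScale hR0]
  simp only [latticeBox, mul_div_assoc]
  refine (card_intBox_le fun i ↦ by linarith [hone i]).trans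
    (Finset.prod_le_prod (fun i _ ↦ ?_) fun i _ ↦ ?_) <;> linarith [hone i]

theorem zero_mem_lattice : (0 : E (n + 1)) ∈ lattice n σ R := ⟨0, by simp, by simp⟩

theorem zero_mem_X (hR : 0 < R) : (0 : E (n + 1)) ∈ X n σ R :=
  ⟨Metric.mem_thickening_iff.2 ⟨0, zero_mem_lattice, by simp⟩, Metric.mem_ball_self hR⟩

theorem X_subset (hR : 1 ≤ R) :
    X n σ R ⊆ ⋃ m ∈ latticeBox n σ R (2 * R), Metric.ball (latticePoint σ R m) 1 := by
  rintro x ⟨hx, hxR⟩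
  obtain ⟨y, hy, hxy⟩ := Metric.mem_thickening_iff.1 hx
  obtain ⟨m, rfl⟩ := exists_latticePoint_eq hy
  refine mem_biUnion ((mem_latticeBox (by linarith)).2 fun i ↦ ?_) hxy
  refine (PiLp.norm_apply_le (latticePoint σ R m) i).trans ?_
  have htri := norm_le_norm_add_norm_sub' (latticePoint σ R m) x
  rw [← dist_eq_norm, dist_comm] at htri
  linarith [mem_ball_zero_iff.1 hxR]

theorem volume_X_le (hσ : σ ≤ 1 / 2) (hR : 1 ≤ R) : volume (X n σ R) ≤
    ENNReal.ofReal (5 ^ (n + 1) * volume.real (Metric.ball (0 : E (n + 1)) 1) *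
      R ^ (((n : ℝ) + 1) - ((n : ℝ) + 2) * σ)) := by
  calc volume (X n σ R)
      ≤ ∑ m ∈ latticeBox n σ R (2 * R), volume (Metric.ball (latticePoint σ R m) 1) :=
        (measure_mono (X_subset hR)).trans (measure_biUnion_finset_le _ _)
    _ = ENNReal.ofReal ((latticeBox n σ R (2 * R)).card *
          volume.real (Metric.ball (0 : E (n + 1)) 1)) := by
        simp only [Measure.addHaar_ball_center]
        rw [Finset.sum_const, nsmul_eq_mul, ENNReal.ofReal_mul (by positivity),
          ENNReal.ofReal_natCast, ofReal_measureReal measure_ball_lt_top.ne]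
    _ ≤ _ := by
        rw [mul_right_comm]
        gcongr
        exact card_latticeBox_two_mul_le hσ hR

/-- The points where the phases of `g` are known to be aligned: a neighbourhood, of measure
comparable to that of `X`, of the lattice points well inside `B_R`. -/
def nearLattice (n : ℕ) (σ R : ℝ) : Set (E (n + 1)) :=
  ⋃ m ∈ latticeBox n σ R (phaseRadius n / (n + 1) * R),
    Metric.ball (latticePoint σ R m) (phaseRadius n)

theorem measurableSet_nearLattice : MeasurableSet (nearLattice n σ R) :=
  Finset.measurableSet_biUnion _ fun _ _ ↦ measurableSet_ball

theorem norm_latticePoint_le (hR : 0 < R) (hm : m ∈ latticeBox n σ R (ρ / (n + 1))) :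
    ‖latticePoint σ R m‖ ≤ ρ := by
  calc ‖latticePoint σ R m‖ ≤ ∑ i, |latticePoint σ R m i| := norm_le_sum_abs _
    _ ≤ ∑ _i : Fin (n + 1), ρ / (n + 1) :=
        Finset.sum_le_sum fun i _ ↦ (mem_latticeBox hR).1 hm i
    _ = ρ := by
        rw [Finset.sum_const, Finset.card_univ, Fintype.card_fin, nsmul_eq_mul, Nat.cast_add_one]
        field_simp

theorem exists_of_mem_nearLattice (hR : 0 < R) (hx : x ∈ nearLattice n σ R) :
    ∃ y ∈ lattice n σ R, ‖y‖ ≤ phaseRadius n * R ∧ dist x y ≤ phaseRadius n := by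
  obtain ⟨m, hm, hx⟩ := mem_iUnion₂.1 hx
  rw [div_mul_eq_mul_div] at hm
  exact ⟨_, latticePoint_mem m, norm_latticePoint_le hR hm, (Metric.mem_ball.1 hx).le⟩

theorem nearLattice_subset_X (hR : 1 ≤ R) : nearLattice n σ R ⊆ X n σ R := by
  intro x hx
  obtain ⟨y, hy, hyR, hxy⟩ := exists_of_mem_nearLattice (by linarith) hx
  have hphase := phaseRadius_le n
  refine ⟨Metric.mem_thickening_iff.2 ⟨y, hy, by linarith⟩, mem_ball_zero_iff.2 ?_⟩
  have htri := norm_le_norm_add_norm_sub' x y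
  rw [← dist_eq_norm] at htri
  nlinarith

theorem le_volume_nearLattice (hσ : 0 < σ) (hR : 1 < R) :
    ENNReal.ofReal ((phaseRadius n / (n + 1)) ^ (n + 1) *
      volume.real (Metric.ball (0 : E (n + 1)) (phaseRadius n)) *
        R ^ (((n : ℝ) + 1) - ((n : ℝ) + 2) * σ)) ≤ volume (nearLattice n σ R) := by
  have hr := phaseRadius_pos n
  have hdisj : ((latticeBox n σ R (phaseRadius n / (n + 1) * R) : Finset _) :
      Set (Fin (n + 1) → ℤ)).PairwiseDisjoint
        fun m ↦ Metric.ball (latticePoint σ R m) (phaseRadius n) := fun m _ m' _ hne ↦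
    Metric.ball_disjoint_ball <|
      le_trans (by linarith [phaseRadius_le n]) (one_le_dist_latticePoint hσ hR hne)
  rw [nearLattice, measure_biUnion_finset hdisj fun _ _ ↦ measurableSet_ball]
  simp only [Measure.addHaar_ball_center]
  rw [Finset.sum_const, nsmul_eq_mul, ← ofReal_measureReal measure_ball_lt_top.ne,
    ← ENNReal.ofReal_natCast, ← ENNReal.ofReal_mul (by positivity), mul_right_comm]
  gcongr
  exact le_card_latticeBox (by linarith) (by positivity)

end Lattice

/-! ### The size of `g` -/

section G

variable {n : ℕ} {σ R : ℝ}

theorem norm_g_le (hR : 0 < R) (x : E (n + 1)) :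
    ‖g n σ R x‖ ≤ (1 + 4 * n) * 2 ^ n * R ^ ((n : ℝ) * (σ - 1)) := by
  rw [g, ext_eq_densityFourierInv]
  exact (norm_densityFourierInv_le hDensity_nonneg x).trans (integral_hDensity_le hR)

theorem le_norm_g (hσ : 0 < σ) (hσ' : σ < 1 / 2) (hR : 1 < R) {x y : E (n + 1)}
    (hy : y ∈ lattice n σ R) (hyR : ‖y‖ ≤ phaseRadius n * R) (hx : dist x y ≤ phaseRadius n) :
    (1 / 2) ^ (n + 1) * R ^ ((n : ℝ) * (σ - 1)) ≤ ‖g n σ R x‖ := by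
  refine le_trans ?_ (half_integral_le_norm_ext_of_mem_lattice hσ' hR hDensity_nonneg
    integrable_hDensity (fun _ h ↦ h) hy hyR hx)
  rw [pow_succ', mul_assoc]
  gcongr
  exact le_integral_hDensity hσ hσ' hR

theorem volume_real_ball_pos {d : ℕ} {r : ℝ} (hr : 0 < r) :
    0 < volume.real (Metric.ball (0 : E d) r) :=
  ENNReal.toReal_pos (Metric.measure_ball_pos _ _ hr).ne' measure_ball_lt_top.ne

theorem exists_lpOn_g_le (hn : 1 ≤ n) : ∃ C : ℝ, ∀ σ R : ℝ, σ ≤ 1 / 2 → 1 ≤ R →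
    lpOn (g n σ R) (X n σ R) ≤ ENNReal.ofReal (C * R ^ sharpExp n σ) := by
  refine ⟨(1 + 4 * n) * 2 ^ n *
    (5 ^ (n + 1) * volume.real (Metric.ball (0 : E (n + 1)) 1)) ^ (pCrit n)⁻¹,
    fun σ R hσ hR ↦ ?_⟩
  have hR0 : 0 < R := zero_lt_one.trans_le hR
  refine (eLpNorm_le_of_norm_le_of_measure_univ_le (pCrit_pos hn) (norm_g_le hR0) (by positivity)
    ((Measure.restrict_apply_univ _).trans_le (volume_X_le hσ hR))).trans_eq ?_
  rw [Real.mul_rpow (by positivity) (by positivity), mul_mul_mul_comm,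
    rpow_mul_rpow_inv_pCrit hR0]

theorem exists_le_lpOn_g (hn : 1 ≤ n) : ∃ c : ℝ, 0 < c ∧
    ∀ σ R : ℝ, 0 < σ → σ < 1 / 2 → 1 < R →
      ENNReal.ofReal (c * R ^ sharpExp n σ) ≤ lpOn (g n σ R) (X n σ R) := by
  have hphase := phaseRadius_pos n
  have hball := volume_real_ball_pos (d := n + 1) hphase
  refine ⟨(1 / 2) ^ (n + 1) * ((phaseRadius n / (n + 1)) ^ (n + 1) *
    volume.real (Metric.ball (0 : E (n + 1)) (phaseRadius n))) ^ (pCrit n)⁻¹, by positivity,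
    fun σ R hσ hσ' hR ↦ ?_⟩
  have hR0 : 0 < R := zero_lt_one.trans hR
  refine Eq.trans_le (Eq.symm ?_) (le_eLpNorm_of_le_norm_of_le_measure (pCrit_pos hn)
    (measurableSet_nearLattice (σ := σ) (R := R))
    (b := (1 / 2) ^ (n + 1) * R ^ ((n : ℝ) * (σ - 1))) (fun x hx ↦ ?_) (by positivity)
    ((le_volume_nearLattice hσ hR).trans_eq ?_))
  · rw [Real.mul_rpow (by positivity) (by positivity), mul_mul_mul_comm,
      rpow_mul_rpow_inv_pCrit hR0]
  · obtain ⟨y, hy, hyR, hxy⟩ := exists_of_mem_nearLattice hR0 hx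
    exact le_norm_g hσ hσ' hR hy hyR hxy
  · rw [Measure.restrict_apply measurableSet_nearLattice,
      inter_eq_left.2 (nearLattice_subset_X hR.le)]

end G

/-! ### Norms of the parts of `g` -/

section CapNorm

variable {n : ℕ} {A σ R s : ℝ} {a : Fin n → ℝ} {w : E (n + 1) → ℝ≥0∞}

/-- The total mass of the model weight `(1 + |y|)^{-(d+1)}`, which controls the mass of every
weight adapted to a ball. -/
def weightMass (n : ℕ) : ℝ := ∫ y : E (n + 1), (1 + ‖y‖) ^ (-((n : ℝ) + 2))

theorem weightMass_nonneg (n : ℕ) : 0 ≤ weightMass n :=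
  integral_nonneg fun y ↦ by positivity

theorem IsBallWeight.withDensity_univ_le (hw : IsBallWeight n A R w) (hA : 0 ≤ A) (hR : 0 < R) :
    (volume.withDensity w) univ ≤ ENNReal.ofReal (A * weightMass n * R ^ ((n : ℝ) + 1)) := by
  set F : E (n + 1) → ℝ := fun y ↦ (1 + ‖y‖) ^ (-((n : ℝ) + 2)) with hF
  have hF0 (y : E (n + 1)) : 0 ≤ F y := by positivity
  have hint : Integrable fun x ↦ A * F (R⁻¹ • x) :=
    ((integrable_one_add_norm (by simp)).comp_smul (by positivity)).const_mul A
  calc (volume.withDensity w) univ = ∫⁻ x, w x := by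
        rw [withDensity_apply _ MeasurableSet.univ, Measure.restrict_univ]
    _ ≤ ∫⁻ x, ENNReal.ofReal (A * F (R⁻¹ • x)) := lintegral_mono fun x ↦ by
        refine (hw.2.2 x).trans_eq ?_
        simp only [hF, norm_smul, norm_inv, Real.norm_of_nonneg hR.le, div_eq_inv_mul]
    _ = ENNReal.ofReal (∫ x, A * F (R⁻¹ • x)) :=
        (ofReal_integral_eq_lintegral_ofReal hint <|
          .of_forall fun x ↦ mul_nonneg hA (hF0 _)).symm
    _ = ENNReal.ofReal (A * weightMass n * R ^ ((n : ℝ) + 1)) := by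
        rw [integral_const_mul, Measure.integral_comp_smul, finrank_euclideanSpace_fin,
          smul_eq_mul, inv_pow, inv_inv, abs_of_pos (by positivity), ← Real.rpow_natCast,
          Nat.cast_add_one, mul_comm (R ^ _), ← mul_assoc, weightMass]

theorem IsBallWeight.smul_restrict_le (hw : IsBallWeight n A R w) :
    ENNReal.ofReal A⁻¹ • volume.restrict (Metric.ball (0 : E (n + 1)) R) ≤
      volume.withDensity w := by
  rw [← withDensity_const, ← withDensity_indicator measurableSet_ball]
  refine withDensity_mono (.of_forall fun x ↦ ?_)
  by_cases hx : x ∈ Metric.ball (0 : E (n + 1)) R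
  · simpa only [indicator_of_mem hx] using hw.2.1 x hx
  · simp only [indicator_of_notMem hx, zero_le]

theorem IsBallWeight.mul_lpOn_ball_le (hn : 1 ≤ n) (hw : IsBallWeight n A R w) (hA : 0 < A)
    (v : E (n + 1) → ℂ) :
    ENNReal.ofReal ((A⁻¹) ^ (pCrit n)⁻¹) * lpOn v (Metric.ball 0 R) ≤
      eLpNorm v (ENNReal.ofReal (pCrit n)) (volume.withDensity w) := by
  have hp := pCrit_pos hn
  have h := eLpNorm_mono_measure (p := ENNReal.ofReal (pCrit n)) v hw.smul_restrict_le
  rwa [eLpNorm_smul_measure_of_ne_zero (ENNReal.ofReal_pos.2 (by positivity)).ne', smul_eq_mul,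
    one_div, ENNReal.toReal_inv, ENNReal.toReal_ofReal hp.le,
    ENNReal.ofReal_rpow_of_nonneg (by positivity) (by positivity)] at h

/-- The exponent of `R` in `‖g_θ‖_{L^p(w)}`. -/
def capExp (n : ℕ) : ℝ := -(n : ℝ) + ((n : ℝ) + 1) / pCrit n

theorem rpow_capExp (hR : 0 < R) :
    R ^ capExp n = R ^ (-(n : ℝ)) * (R ^ ((n : ℝ) + 1)) ^ (pCrit n)⁻¹ := by
  rw [← Real.rpow_mul hR.le, ← Real.rpow_add hR, capExp, div_eq_mul_inv]

theorem rpow_half_mul_rpow_capExp (hR : 0 < R) :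
    (R ^ ((n : ℝ) * σ)) ^ (1 / 2 : ℝ) * R ^ capExp n = R ^ sharpExp n σ := by
  rw [← Real.rpow_mul hR.le, ← Real.rpow_add hR, sharpExp_eq, capExp, div_eq_mul_inv _ (pCrit n),
    inv_pCrit]
  congr 1
  field_simp
  ring

theorem capNorm_le (hn : 1 ≤ n) (hA : 0 ≤ A) (hσ : σ < 1 / 2) (hR : 1 < R) (hs : IsCapSide R s)
    (hw : IsBallWeight n A R w) (k : Fin n → ℤ) :
    capNorm (hDensity n σ R) s a w k ≤
      ENNReal.ofReal (capBound n * (A * weightMass n) ^ (pCrit n)⁻¹ * R ^ capExp n) := by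
  have hR0 : 0 < R := zero_lt_one.trans hR
  have hmass := weightMass_nonneg n
  refine (eLpNorm_le_of_norm_le_of_measure_univ_le (pCrit_pos hn) (norm_capPart_le hσ hR hs)
    (by positivity) (hw.withDensity_univ_le hA hR0)).trans_eq ?_
  rw [Real.mul_rpow (by positivity) (by positivity), mul_mul_mul_comm, rpow_capExp hR0]

/-- A lower bound for the mean of `|g_θ|` over `B_R` in units of `R^{-(d-1)}`, valid for the caps
`θ` that contain a large part of a frequency box. -/
def capMean (n : ℕ) : ℝ := 1 / 4 * (1 / 4) ^ n * (18 * ((n : ℝ) + 1))⁻¹ ^ (n + 1)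

theorem capMean_pos (n : ℕ) : 0 < capMean n := by
  unfold capMean
  positivity

theorem le_lintegral_capPart (hσ : σ < 1 / 2) (hR : 1 < R) (hs : IsCapSide R s)
    {l : Fin n → ℤ} (hl : l ∈ freqs n σ R) :
    ENNReal.ofReal (capMean n * R ^ (-(n : ℝ))) * volume (Metric.ball (0 : E (n + 1)) R) ≤
      ∫⁻ x in Metric.ball (0 : E (n + 1)) R,
        ‖capPart (hDensity n σ R) s a (capIndex σ R s a l) x‖ₑ := by
  have hR0 : 0 < R := zero_lt_one.trans hR
  obtain ⟨S, hS, hSvol, hSbox, hSdensity⟩ := exists_subset_cap (a := a) hσ hR hs hl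
  set κ : ℝ := (18 * ((n : ℝ) + 1))⁻¹ with hκ
  have hκ0 : 0 < κ := by positivity
  have hκn : κ * (n + 1) = 1 / 18 := by rw [hκ]; field_simp
  have hκ1 : 2 * κ ≤ 1 := by nlinarith [(Nat.cast_nonneg n : (0 : ℝ) ≤ n)]
  have hcenter : ∀ ξ ∈ S, ξ ∈ paraboloid n →
      κ * R * ‖ξ - paraLift (freqCenter σ R l)‖ ≤ 1 / 6 := fun ξ hξS hξ ↦
    calc κ * R * ‖ξ - paraLift (freqCenter σ R l)‖ ≤ κ * R * (3 * n * R⁻¹) := by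
          gcongr
          exact norm_sub_paraLift_le hξ (abs_freqCenter_le_one hσ hR hl) fun i ↦
            (mem_freqBox.1 (hSbox ξ hξS) i).le
      _ = 3 * (κ * n) := by field_simp
      _ ≤ 1 / 6 := by linarith
  have hlower := le_lintegral_ball_densityFourierInv capDensity_nonneg
    integrable_capDensity (paraLift (freqCenter σ R l)) (r := κ * R) (mul_pos hκ0 hR0) hS <| by
      filter_upwards [ae_mem_paraboloid n] with ξ hξ hξS
      exact ⟨hSdensity ξ hξS hξ, hcenter ξ hξS hξ⟩
  simp only [← ext_eq_densityFourierInv] at hlower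
  calc _ = ENNReal.ofReal (1 / 4) * ENNReal.ofReal ((1 / 4) ^ n * R ^ (-(n : ℝ))) *
        volume (Metric.ball (0 : E (n + 1)) (κ * R)) := by
        rw [Measure.addHaar_ball_mul _ _ hκ0.le, finrank_euclideanSpace_fin, ← mul_assoc,
          ← ENNReal.ofReal_mul (by positivity), ← ENNReal.ofReal_mul (by positivity), capMean, ← hκ]
        ring_nf
    _ ≤ ENNReal.ofReal (1 / 4) * surfaceMeasure n S *
        volume (Metric.ball (0 : E (n + 1)) (κ * R)) := by
        gcongr
        exact (ENNReal.ofReal_le_iff_le_toReal (measure_ne_top _ _)).2 hSvol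
    _ ≤ _ := hlower.trans (lintegral_mono_set (Metric.ball_subset_ball (by nlinarith [hκ1])))

theorem le_lpOn_ball_capPart (hn : 1 ≤ n) (hσ : σ < 1 / 2) (hR : 1 < R) (hs : IsCapSide R s)
    {l : Fin n → ℤ} (hl : l ∈ freqs n σ R) :
    ENNReal.ofReal (capMean n * volume.real (Metric.ball (0 : E (n + 1)) 1) ^ (pCrit n)⁻¹ *
        R ^ capExp n) ≤
      lpOn (capPart (hDensity n σ R) s a (capIndex σ R s a l)) (Metric.ball 0 R) := by
  have hR0 : 0 < R := zero_lt_one.trans hR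
  have hp := pCrit_pos hn
  have hmean := capMean_pos n
  have hcont : Continuous (capPart (hDensity n σ R) s a (capIndex σ R s a l)) := by
    rw [capPart_hDensity, ext_eq_densityFourierInv]
    exact continuous_densityFourierInv integrable_capDensity
  have hfinite : IsFiniteMeasure (volume.restrict (Metric.ball (0 : E (n + 1)) R)) :=
    isFiniteMeasure_restrict.2 measure_ball_lt_top.ne
  have hrestrict : volume.restrict (Metric.ball (0 : E (n + 1)) R) ≠ 0 :=
    mt Measure.restrict_eq_zero.1 (Metric.measure_ball_pos _ _ hR0).ne'
  refine Eq.trans_le ?_ (mul_rpow_measure_univ_le_eLpNorm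
    (m := ENNReal.ofReal (capMean n * R ^ (-(n : ℝ)))) hrestrict
    (by linarith [two_lt_pCrit hn]) hcont.aestronglyMeasurable ?_)
  · rw [Measure.restrict_apply_univ, Measure.addHaar_ball _ _ hR0.le, finrank_euclideanSpace_fin,
      ← ofReal_measureReal measure_ball_lt_top.ne, ← ENNReal.ofReal_mul (by positivity),
      ENNReal.ofReal_rpow_of_nonneg (by positivity) (by positivity),
      ← ENNReal.ofReal_mul (by positivity), Real.mul_rpow (by positivity) (by positivity),
      ← Real.rpow_natCast, rpow_capExp hR0, Nat.cast_add_one]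
    ring_nf
  · rw [Measure.restrict_apply_univ]
    exact le_lintegral_capPart hσ hR hs hl

theorem le_capNorm (hn : 1 ≤ n) (hA : 0 < A) (hσ : σ < 1 / 2) (hR : 1 < R) (hs : IsCapSide R s)
    (hw : IsBallWeight n A R w) {l : Fin n → ℤ} (hl : l ∈ freqs n σ R) :
    ENNReal.ofReal ((A⁻¹) ^ (pCrit n)⁻¹ * (capMean n *
        volume.real (Metric.ball (0 : E (n + 1)) 1) ^ (pCrit n)⁻¹) * R ^ capExp n) ≤
      capNorm (hDensity n σ R) s a w (capIndex σ R s a l) := by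
  refine le_trans ?_ (hw.mul_lpOn_ball_le hn hA _)
  rw [mul_assoc, ENNReal.ofReal_mul (by positivity)]
  gcongr
  exact le_lpOn_ball_capPart hn hσ hR hs hl

theorem tsum_rpow_rpow_le {ι : Type*} {f : ι → ℝ≥0∞} {S : Finset ι} {N b q : ℝ} (hq : 0 < q)
    (hb : 0 ≤ b) (hS : ∀ k ∉ S, f k = 0) (hN : S.card ≤ N) (hf : ∀ k, f k ≤ ENNReal.ofReal b) :
    (∑' k, f k ^ q) ^ (1 / q) ≤ ENNReal.ofReal (N ^ (1 / q) * b) := by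
  have hN0 : 0 ≤ N := (Nat.cast_nonneg _).trans hN
  have hsum : ∑' k, f k ^ q ≤ ENNReal.ofReal (N * b ^ q) :=
    calc ∑' k, f k ^ q = ∑ k ∈ S, f k ^ q :=
          tsum_eq_sum fun k hk ↦ by rw [hS k hk, ENNReal.zero_rpow_of_pos hq]
      _ ≤ ∑ _k ∈ S, ENNReal.ofReal b ^ q := by gcongr with k; exact hf k
      _ = ENNReal.ofReal (S.card * b ^ q) := by
          rw [Finset.sum_const, nsmul_eq_mul, ENNReal.ofReal_mul (by positivity),
            ENNReal.ofReal_natCast, ENNReal.ofReal_rpow_of_nonneg hb hq.le]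
      _ ≤ _ := by gcongr
  refine (ENNReal.rpow_le_rpow hsum (by positivity)).trans_eq ?_
  rw [ENNReal.ofReal_rpow_of_nonneg (by positivity) (by positivity),
    Real.mul_rpow hN0 (by positivity), ← Real.rpow_mul hb, mul_one_div_cancel hq.ne',
    Real.rpow_one]

theorem le_tsum_rpow_rpow {ι : Type*} {f : ι → ℝ≥0∞} {S : Finset ι} {N b q : ℝ} (hq : 0 < q)
    (hb : 0 ≤ b) (hN0 : 0 ≤ N) (hN : N ≤ S.card) (hf : ∀ k ∈ S, ENNReal.ofReal b ≤ f k) :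
    ENNReal.ofReal (N ^ (1 / q) * b) ≤ (∑' k, f k ^ q) ^ (1 / q) := by
  have hsum : ENNReal.ofReal (N * b ^ q) ≤ ∑' k, f k ^ q :=
    calc ENNReal.ofReal (N * b ^ q) ≤ ENNReal.ofReal (S.card * b ^ q) := by gcongr
      _ = ∑ _k ∈ S, ENNReal.ofReal b ^ q := by
          rw [Finset.sum_const, nsmul_eq_mul, ENNReal.ofReal_mul (by positivity),
            ENNReal.ofReal_natCast, ENNReal.ofReal_rpow_of_nonneg hb hq.le]
      _ ≤ ∑ k ∈ S, f k ^ q := by gcongr with k hk; exact hf k hk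
      _ ≤ ∑' k, f k ^ q := ENNReal.sum_le_tsum S
  refine Eq.trans_le ?_ (ENNReal.rpow_le_rpow hsum (by positivity))
  rw [ENNReal.ofReal_rpow_of_nonneg (by positivity) (by positivity),
    Real.mul_rpow hN0 (by positivity), ← Real.rpow_mul hb, mul_one_div_cancel hq.ne',
    Real.rpow_one]

theorem exists_capSum_le (hn : 1 ≤ n) (hA : 0 ≤ A) {q : ℝ} (hq : 0 < q) : ∃ C : ℝ,
    ∀ σ R s : ℝ, σ < 1 / 2 → 1 < R → IsCapSide R s → ∀ (a : Fin n → ℝ) (w : E (n + 1) → ℝ≥0∞),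
      IsBallWeight n A R w → capSum (hDensity n σ R) s a w q ≤
        ENNReal.ofReal (C * ((R ^ ((n : ℝ) * σ)) ^ (1 / q) * R ^ capExp n)) := by
  have hmass := weightMass_nonneg n
  have hbound := capBound_pos n
  refine ⟨((5 : ℝ) ^ n) ^ (1 / q) * (capBound n * (A * weightMass n) ^ (pCrit n)⁻¹),
    fun σ R s hσ hR hs a w hw ↦ ?_⟩
  have hR0 : 0 < R := zero_lt_one.trans hR
  refine (tsum_rpow_rpow_le (S := activeCaps σ R s a) hq (by positivity) (fun k hk ↦ ?_)
    (card_activeCaps_le hR0) (capNorm_le hn hA hσ hR hs hw)).trans_eq ?_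
  · rw [capNorm, capPart_eq_zero hR.le hs hk, eLpNorm_zero]
  · rw [Real.mul_rpow (by positivity) (by positivity), mul_mul_mul_comm]

theorem exists_le_capSum (hn : 1 ≤ n) (hA : 0 < A) {q : ℝ} (hq : 0 < q) : ∃ c : ℝ, 0 < c ∧
    ∀ σ R s : ℝ, 0 < σ → σ < 1 / 2 → 1 < R → IsCapSide R s →
      ∀ (a : Fin n → ℝ) (w : E (n + 1) → ℝ≥0∞), IsBallWeight n A R w →
        ENNReal.ofReal (c * ((R ^ ((n : ℝ) * σ)) ^ (1 / q) * R ^ capExp n)) ≤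
          capSum (hDensity n σ R) s a w q := by
  have hmean := capMean_pos n
  have hball := volume_real_ball_pos (d := n + 1) one_pos
  refine ⟨((1 / 2 : ℝ) ^ n) ^ (1 / q) * ((A⁻¹) ^ (pCrit n)⁻¹ * (capMean n *
    volume.real (Metric.ball (0 : E (n + 1)) 1) ^ (pCrit n)⁻¹)), by positivity,
    fun σ R s hσ hσ' hR hs a w hw ↦ ?_⟩
  have hinj := capIndex_injective (a := a) hσ' hR hs
  refine Eq.trans_le (Eq.symm ?_) (le_tsum_rpow_rpow (S := (freqs n σ R).map ⟨_, hinj⟩) hq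
    (b := (A⁻¹) ^ (pCrit n)⁻¹ * (capMean n *
      volume.real (Metric.ball (0 : E (n + 1)) 1) ^ (pCrit n)⁻¹) * R ^ capExp n) (by positivity)
    (by positivity) ((le_card_freqs hσ hR).trans_eq (by rw [Finset.card_map])) ?_)
  · rw [Real.mul_rpow (by positivity) (by positivity), mul_mul_mul_comm]
  · simp only [Finset.forall_mem_map, Function.Embedding.coeFn_mk]
    exact fun l hl ↦ le_capNorm hn hA hσ' hR hs hw hl

end CapNorm

/-! ### Wave packets -/

section Profile

variable {d : ℕ} (φ : Profile d)

theorem Profile.exists_norm_le : ∃ C : ℝ, ∀ y, ‖φ.η y‖ ≤ C := by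
  obtain ⟨C, -, hC⟩ := φ.η.decay 0 0
  exact ⟨C, fun y ↦ by simpa using hC y⟩

theorem Profile.exists_le_norm :
    ∃ c : ℝ, 0 < c ∧ ∀ y : E d, (∀ i, |y i| ≤ 1 / 2) → c ≤ ‖φ.η y‖ := by
  have hcube : IsCompact {y : E d | ∀ i, |y i| ≤ 1 / 2} := by
    refine Metric.isCompact_of_isClosed_isBounded ?_ ?_
    · simp only [ofPred_forall]
      exact isClosed_iInter fun i ↦ isClosed_le (by fun_prop) continuous_const
    · refine isBounded_iff_forall_norm_le.2 ⟨∑ _i : Fin d, 1 / 2, fun y hy ↦ ?_⟩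
      exact (norm_le_sum_abs y).trans (Finset.sum_le_sum fun i _ ↦ hy i)
  obtain ⟨y₀, hy₀, hmin⟩ :=
    hcube.exists_isMinOn ⟨0, fun i ↦ by simp⟩ φ.η.continuous.norm.continuousOn
  exact ⟨‖φ.η y₀‖, norm_pos_iff.2 (φ.ne_zero y₀ hy₀), fun y hy ↦ hmin hy⟩

end Profile

section WavePackets

variable {n : ℕ} {σ R K s c C D lam : ℝ} {a : Fin n → ℝ} {φ : Profile (n + 1)}
  {𝔅 : CapBoxes n R K s a} {f : E (n + 1) → ℝ} {k : Fin n → ℤ} {m : Fin (n + 1) → ℤ}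
  {x y : E (n + 1)}

/-- The index of the tile through `x` in the tiling by translates of `T_θ`. -/
def CapBoxes.tubeIndex (𝔅 : CapBoxes n R K s a) (k : Fin n → ℤ) (x : E (n + 1)) :
    Fin (n + 1) → ℤ :=
  fun i ↦ ⌊𝔅.coord k x i + 1 / 2⌋

theorem CapBoxes.mem_tube_iff : x ∈ 𝔅.tube k m ↔ 𝔅.tubeIndex k x = m := by
  rw [funext_iff]
  refine forall_congr' fun i ↦ ?_
  rw [tubeIndex, Int.floor_eq_iff, mem_Ico]
  constructor <;> rintro ⟨h, h'⟩ <;> constructor <;> linarith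

theorem magnitude_le (hC : ∀ y, ‖φ.η y‖ ≤ C) (hD : ∀ x, ‖capPart f s a k x‖ ≤ D) :
    magnitude φ 𝔅 f k m ≤ ENNReal.ofReal (C * D) := by
  refine iSup₂_le fun x _ ↦ ?_
  rw [← ofReal_norm, wavePacket, norm_mul]
  gcongr
  · exact (norm_nonneg _).trans (hC 0)
  · exact hC _
  · exact hD x

theorem le_magnitude (hc0 : 0 ≤ c)
    (hc : ∀ y : E (n + 1), (∀ i, |y i| ≤ 1 / 2) → c ≤ ‖φ.η y‖)
    (hx : x ∈ 𝔅.tube k m) (hD : D ≤ ‖capPart f s a k x‖) :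
    ENNReal.ofReal (c * D) ≤ magnitude φ 𝔅 f k m := by
  refine le_trans ?_ (le_iSup₂ x hx)
  rw [← ofReal_norm, wavePacket, norm_mul]
  refine ENNReal.ofReal_le_ofReal ((mul_le_mul_of_nonneg_left hD hc0).trans
    (mul_le_mul_of_nonneg_right (hc _ fun i ↦ ?_) (norm_nonneg _)))
  have hxi := hx i
  simp only [PiLp.sub_apply, intVec, abs_le]
  constructor <;> linarith [hxi.1, hxi.2]

theorem packetsAt_subset (hR : 1 ≤ R) (hs : IsCapSide R s) (hlam : 0 < lam) :
    packetsAt φ 𝔅 (hDensity n σ R) lam x ⊆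
      (fun k ↦ (k, 𝔅.tubeIndex k x)) '' activeCaps σ R s a := by
  rintro ⟨k, m⟩ ⟨-, hx, hm⟩
  refine ⟨k, ?_, Prod.ext rfl (CapBoxes.mem_tube_iff.1 hx)⟩
  by_contra hk
  have hzero : magnitude φ 𝔅 (hDensity n σ R) k m = 0 := by
    simp [magnitude, wavePacket, capPart_eq_zero hR hs hk]
  rw [hzero] at hm
  exact hlam.not_ge (ENNReal.ofReal_eq_zero.1 (nonpos_iff_eq_zero.1 hm))

theorem encard_packetsAt_le (hR : 1 ≤ R) (hs : IsCapSide R s) (hlam : 0 < lam) :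
    ((packetsAt φ 𝔅 (hDensity n σ R) lam x).encard : ℝ≥0∞) ≤
      ENNReal.ofReal (5 ^ n * R ^ ((n : ℝ) * σ)) := by
  have hcard : (packetsAt φ 𝔅 (hDensity n σ R) lam x).encard ≤ (activeCaps σ R s a).card :=
    (encard_le_encard (packetsAt_subset hR hs hlam)).trans
      ((encard_image_le _ _).trans_eq (encard_coe_eq_coe_finsetCard _))
  refine (ENat.toENNReal_le.2 hcard).trans ?_
  rw [ENat.toENNReal_coe, ← ENNReal.ofReal_natCast]
  exact ENNReal.ofReal_le_ofReal (card_activeCaps_le (by linarith))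

theorem image_freqs_subset_packetsAt (hσ : σ < 1 / 2) (hR : 1 < R) (hs : IsCapSide R s)
    (hc0 : 0 ≤ c) (hc : ∀ y : E (n + 1), (∀ i, |y i| ≤ 1 / 2) → c ≤ ‖φ.η y‖)
    (hlam : lam ≤ c * (1 / 2 * ((1 / 4) ^ n * R ^ (-(n : ℝ)))))
    (hy : y ∈ lattice n σ R) (hyR : ‖y‖ ≤ phaseRadius n * R) :
    (fun l ↦ (capIndex σ R s a l, 𝔅.tubeIndex (capIndex σ R s a l) y)) '' freqs n σ R ⊆
      packetsAt φ 𝔅 (hDensity n σ R) lam y := by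
  rintro _ ⟨l, hl, rfl⟩
  have hmem : y ∈ 𝔅.tube (capIndex σ R s a l) (𝔅.tubeIndex (capIndex σ R s a l) y) :=
    CapBoxes.mem_tube_iff.2 rfl
  refine ⟨⟨y, hmem, mem_ball_zero_iff.2 ?_⟩, hmem, ?_⟩
  · nlinarith [phaseRadius_le n]
  · exact (ENNReal.ofReal_le_ofReal hlam).trans
      (le_magnitude hc0 hc hmem (le_norm_capPart_of_mem_lattice hσ hR hs hl hy hyR))

theorem le_encard_packetsAt (hσ : 0 < σ) (hσ' : σ < 1 / 2) (hR : 1 < R) (hs : IsCapSide R s)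
    (hc0 : 0 ≤ c) (hc : ∀ y : E (n + 1), (∀ i, |y i| ≤ 1 / 2) → c ≤ ‖φ.η y‖)
    (hlam : lam ≤ c * (1 / 2 * ((1 / 4) ^ n * R ^ (-(n : ℝ)))))
    (hy : y ∈ lattice n σ R) (hyR : ‖y‖ ≤ phaseRadius n * R) :
    ENNReal.ofReal ((1 / 2) ^ n * R ^ ((n : ℝ) * σ)) ≤
      ((packetsAt φ 𝔅 (hDensity n σ R) lam y).encard : ℝ≥0∞) := by
  have hinj : Function.Injective fun l ↦
      (capIndex σ R s a l, 𝔅.tubeIndex (capIndex σ R s a l) y) := fun l l' h ↦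
    capIndex_injective hσ' hR hs (congrArg Prod.fst h)
  have hcard : ((freqs n σ R).card : ℕ∞) ≤ (packetsAt φ 𝔅 (hDensity n σ R) lam y).encard := by
    rw [← encard_coe_eq_coe_finsetCard, ← hinj.encard_image]
    exact encard_le_encard (image_freqs_subset_packetsAt hσ' hR hs hc0 hc hlam hy hyR)
  refine le_trans ?_ (ENat.toENNReal_le.2 hcard)
  rw [ENat.toENNReal_coe, ← ENNReal.ofReal_natCast]
  exact ENNReal.ofReal_le_ofReal (le_card_freqs hσ hR)

theorem multiplicity_le (hR : 1 ≤ R) (hs : IsCapSide R s) (hlam : 0 < lam)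
    (Y : Set (E (n + 1))) :
    multiplicity φ 𝔅 (hDensity n σ R) lam Y ≤ ENNReal.ofReal (5 ^ n * R ^ ((n : ℝ) * σ)) :=
  iSup₂_le fun _ _ ↦ encard_packetsAt_le hR hs hlam

theorem le_multiplicity (hσ : 0 < σ) (hσ' : σ < 1 / 2) (hR : 1 < R) (hs : IsCapSide R s)
    (hc0 : 0 ≤ c) (hc : ∀ y : E (n + 1), (∀ i, |y i| ≤ 1 / 2) → c ≤ ‖φ.η y‖)
    (hlam : lam ≤ c * (1 / 2 * ((1 / 4) ^ n * R ^ (-(n : ℝ))))) :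
    ENNReal.ofReal ((1 / 2) ^ n * R ^ ((n : ℝ) * σ)) ≤
      multiplicity φ 𝔅 (hDensity n σ R) lam (X n σ R) := by
  have hphase := phaseRadius_pos n
  have hzero : ‖(0 : E (n + 1))‖ ≤ phaseRadius n * R := by
    rw [norm_zero]
    positivity
  exact (le_encard_packetsAt hσ hσ' hR hs hc0 hc hlam zero_mem_lattice hzero).trans
    (le_iSup₂ (f := fun x (_ : x ∈ X n σ R) ↦
      ((packetsAt φ 𝔅 (hDensity n σ R) lam x).encard : ℝ≥0∞)) 0 (zero_mem_X (by linarith)))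

end WavePackets

section RefinedRHS

variable {n : ℕ} {σ R K s M N lam : ℝ} {a : Fin n → ℝ} {φ : Profile (n + 1)}
  {𝔅 : CapBoxes n R K s a} {f : E (n + 1) → ℝ} {Y : Set (E (n + 1))} {w : E (n + 1) → ℝ≥0∞}

theorem half_sub_inv_pCrit_pos (hn : 1 ≤ n) : 0 < 1 / 2 - 1 / pCrit n :=
  sub_pos.2 (one_div_lt_one_div_of_lt two_pos (two_lt_pCrit hn))

theorem ofReal_mul_rpow_mul_eq (hn : 1 ≤ n) (hR : 0 < R) (hM : 0 ≤ M) (ε : ℝ) :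
    ENNReal.ofReal (R ^ ε) * ENNReal.ofReal (M * R ^ ((n : ℝ) * σ)) ^ (1 / 2 - 1 / pCrit n) *
        ENNReal.ofReal (N * ((R ^ ((n : ℝ) * σ)) ^ (1 / pCrit n) * R ^ capExp n)) =
      ENNReal.ofReal (M ^ (1 / 2 - 1 / pCrit n) * N * R ^ (sharpExp n σ + ε)) := by
  have hpos : 0 < R ^ ((n : ℝ) * σ) := by positivity
  have hhalf : (R ^ ((n : ℝ) * σ)) ^ (1 / 2 : ℝ) =
      (R ^ ((n : ℝ) * σ)) ^ (1 / 2 - 1 / pCrit n) * (R ^ ((n : ℝ) * σ)) ^ (1 / pCrit n) := by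
    rw [← Real.rpow_add hpos, sub_add_cancel]
  rw [ENNReal.ofReal_rpow_of_nonneg (by positivity) (half_sub_inv_pCrit_pos hn).le,
    ← ENNReal.ofReal_mul (by positivity), ← ENNReal.ofReal_mul (by positivity),
    Real.mul_rpow hM hpos.le, Real.rpow_add hR, ← rpow_half_mul_rpow_capExp hR, hhalf]
  ring_nf

theorem refinedRHS_le (hn : 1 ≤ n) (hR : 0 < R) (hM0 : 0 ≤ M)
    (hM : multiplicity φ 𝔅 f lam Y ≤ ENNReal.ofReal (M * R ^ ((n : ℝ) * σ)))
    (hN : capSum f s a w (pCrit n) ≤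
      ENNReal.ofReal (N * ((R ^ ((n : ℝ) * σ)) ^ (1 / pCrit n) * R ^ capExp n))) (ε : ℝ) :
    refinedRHS φ 𝔅 f lam Y w ε ≤
      ENNReal.ofReal (M ^ (1 / 2 - 1 / pCrit n) * N * R ^ (sharpExp n σ + ε)) := by
  rw [← ofReal_mul_rpow_mul_eq hn hR hM0, refinedRHS]
  have := half_sub_inv_pCrit_pos hn
  gcongr

theorem le_refinedRHS (hn : 1 ≤ n) (hR : 0 < R) (hM0 : 0 ≤ M)
    (hM : ENNReal.ofReal (M * R ^ ((n : ℝ) * σ)) ≤ multiplicity φ 𝔅 f lam Y)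
    (hN : ENNReal.ofReal (N * ((R ^ ((n : ℝ) * σ)) ^ (1 / pCrit n) * R ^ capExp n)) ≤
      capSum f s a w (pCrit n)) (ε : ℝ) :
    ENNReal.ofReal (M ^ (1 / 2 - 1 / pCrit n) * N * R ^ (sharpExp n σ + ε)) ≤
      refinedRHS φ 𝔅 f lam Y w ε := by
  rw [← ofReal_mul_rpow_mul_eq hn hR hM0, refinedRHS]
  have := half_sub_inv_pCrit_pos hn
  gcongr

end RefinedRHS

/-! ### Uniform constants -/

open Filter

section Constants

variable {c : ℝ}

theorem eventually_inv_le (hc : 0 < c) : ∀ᶠ C : ℝ in atTop, C⁻¹ ≤ c :=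
  tendsto_inv_atTop_zero.eventually_le_const hc

theorem eventually_comparable (hc : 0 < c) (C₀ : ℝ) :
    ∀ᶠ C : ℝ in atTop, ∀ (Y : ℝ≥0∞) (B : ℝ), 0 ≤ B → ENNReal.ofReal (c * B) ≤ Y →
      Y ≤ ENNReal.ofReal (C₀ * B) → Comparable C Y B := by
  filter_upwards [eventually_inv_le hc, eventually_ge_atTop C₀] with C hCc hC Y B hB hcY hYC
  exact ⟨le_trans (by gcongr) hcY, hYC.trans (by gcongr)⟩

theorem eventually_le_ofReal_mul (hc : 0 < c) (C₀ : ℝ) :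
    ∀ᶠ C : ℝ in atTop, ∀ (Y Z : ℝ≥0∞) (B r : ℝ), 0 ≤ B → 0 ≤ r →
      Y ≤ ENNReal.ofReal (C₀ * (B * r)) → ENNReal.ofReal (c * B) ≤ Z →
        Y ≤ ENNReal.ofReal (C * r) * Z := by
  filter_upwards [eventually_ge_atTop (C₀ * c⁻¹), eventually_ge_atTop 0]
    with C hC hC0 Y Z B r hB hr hY hZ
  calc Y ≤ ENNReal.ofReal (C₀ * c⁻¹ * r * (c * B)) := by
        convert hY using 2
        field_simp
    _ ≤ ENNReal.ofReal (C * r * (c * B)) := by gcongr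
    _ = ENNReal.ofReal (C * r) * ENNReal.ofReal (c * B) := ENNReal.ofReal_mul (by positivity)
    _ ≤ ENNReal.ofReal (C * r) * Z := by gcongr

theorem eventually_inv_mul_le (hc : 0 < c) (n : ℕ) :
    ∀ᶠ C : ℝ in atTop, ∀ R : ℝ, 0 < R →
      C⁻¹ * R ^ (-(n : ℝ)) ≤ c * (1 / 2 * ((1 / 4) ^ n * R ^ (-(n : ℝ)))) := by
  filter_upwards [eventually_inv_le (c := c * (1 / 2) * (1 / 4) ^ n) (by positivity)] with C hC R hR
  calc C⁻¹ * R ^ (-(n : ℝ)) ≤ c * (1 / 2) * (1 / 4) ^ n * R ^ (-(n : ℝ)) := by gcongr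
    _ = c * (1 / 2 * ((1 / 4) ^ n * R ^ (-(n : ℝ)))) := by ring

end Constants

section Example

variable {n : ℕ}

theorem eventually_norm_g_le : ∀ᶠ C : ℝ in atTop, ∀ σ R : ℝ, 0 < R → ∀ x,
    ‖g n σ R x‖ ≤ C * R ^ ((n : ℝ) * (σ - 1)) := by
  filter_upwards [eventually_ge_atTop ((1 + 4 * n) * 2 ^ n : ℝ)] with C hC σ R hR x
  exact (norm_g_le hR x).trans (by gcongr)

theorem eventually_le_norm_g : ∀ᶠ C : ℝ in atTop, ∀ σ R : ℝ, 0 < σ → σ < 1 / 2 → 1 < R →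
    ∀ y ∈ lattice n σ R, ‖y‖ < C⁻¹ * R → ∀ x, dist x y ≤ C⁻¹ →
      C⁻¹ * R ^ ((n : ℝ) * (σ - 1)) ≤ ‖g n σ R x‖ := by
  filter_upwards [eventually_inv_le (phaseRadius_pos n),
    eventually_inv_le (c := (1 / 2) ^ (n + 1)) (by positivity)]
    with C hphase hC σ R hσ hσ' hR y hy hyR x hx
  exact le_trans (by gcongr)
    (le_norm_g hσ hσ' hR hy (hyR.le.trans (by gcongr)) (hx.trans hphase))

theorem eventually_comparable_volume_X : ∀ᶠ C : ℝ in atTop, ∀ σ R : ℝ, 0 < σ → σ < 1 / 2 → 1 < R →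
    Comparable C (volume (X n σ R)) (R ^ (((n : ℝ) + 1) - ((n : ℝ) + 2) * σ)) := by
  have hphase := phaseRadius_pos n
  have hball := volume_real_ball_pos (d := n + 1) hphase
  filter_upwards [eventually_comparable (by positivity :
      0 < (phaseRadius n / (n + 1)) ^ (n + 1) *
        volume.real (Metric.ball (0 : E (n + 1)) (phaseRadius n)))
    (5 ^ (n + 1) * volume.real (Metric.ball (0 : E (n + 1)) 1))] with C hC σ R hσ hσ' hR
  exact hC _ _ (by positivity)
    ((le_volume_nearLattice hσ hR).trans (measure_mono (nearLattice_subset_X hR.le)))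
    (volume_X_le hσ'.le hR.le)

theorem eventually_comparable_lpOn_g (hn : 1 ≤ n) :
    ∀ᶠ C : ℝ in atTop, ∀ σ R : ℝ, 0 < σ → σ < 1 / 2 → 1 < R →
      Comparable C (lpOn (g n σ R) (X n σ R)) (R ^ sharpExp n σ) := by
  obtain ⟨C₀, hC₀⟩ := exists_lpOn_g_le hn
  obtain ⟨c, hc0, hc⟩ := exists_le_lpOn_g hn
  filter_upwards [eventually_comparable hc0 C₀] with C hC σ R hσ hσ' hR
  exact hC _ _ (by positivity) (hc σ R hσ hσ' hR) (hC₀ σ R hσ'.le hR.le)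

end Example

section Caps

variable {n : ℕ} {A : ℝ}

theorem eventually_norm_capPart_le : ∀ᶠ C : ℝ in atTop, ∀ σ R : ℝ, σ < 1 / 2 → 1 < R →
    ∀ (s : ℝ) (a : Fin n → ℝ), IsCapSide R s →
      ∀ k x, ‖capPart (hDensity n σ R) s a k x‖ ≤ C * R ^ (-(n : ℝ)) := by
  filter_upwards [eventually_ge_atTop (capBound n)] with C hC σ R hσ hR s a hs k x
  exact (norm_capPart_le hσ hR hs x).trans (by gcongr)

theorem eventually_capNorm_le (hn : 1 ≤ n) (hA : 0 ≤ A) :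
    ∀ᶠ C : ℝ in atTop, ∀ σ R : ℝ, σ < 1 / 2 → 1 < R →
      ∀ (s : ℝ) (a : Fin n → ℝ), IsCapSide R s → ∀ w, IsBallWeight n A R w →
        ∀ k, capNorm (hDensity n σ R) s a w k ≤ ENNReal.ofReal (C * R ^ capExp n) := by
  filter_upwards [eventually_ge_atTop (capBound n * (A * weightMass n) ^ (pCrit n)⁻¹)]
    with C hC σ R hσ hR s a hs w hw k
  exact (capNorm_le hn hA hσ hR hs hw k).trans (by gcongr)

theorem eventually_le_norm_capPart : ∀ᶠ C : ℝ in atTop, ∀ σ R : ℝ, σ < 1 / 2 → 1 < R →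
    ∀ (s : ℝ) (a : Fin n → ℝ), IsCapSide R s → IsAdapted n σ R s a →
      ∀ k, capPart (hDensity n σ R) s a k ≠ 0 → ∀ x, ‖x‖ < C⁻¹ * R →
        C⁻¹ * R ^ (-(n : ℝ)) ≤ ‖capPart (hDensity n σ R) s a k x‖ := by
  filter_upwards [eventually_inv_le (phaseRadius_pos n), eventually_inv_mul_le one_pos n]
    with C hphase hC σ R hσ hR s a hs had k hk x hx
  have hlow := hC R (by linarith)
  rw [one_mul] at hlow
  exact hlow.trans (had.le_norm_capPart hσ hR hs hk (hx.le.trans (by gcongr)))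

theorem eventually_comparable_capNorm (hn : 1 ≤ n) (hA : 0 < A) :
    ∀ᶠ C : ℝ in atTop, ∀ σ R : ℝ, σ < 1 / 2 → 1 < R →
      ∀ (s : ℝ) (a : Fin n → ℝ), IsCapSide R s → ∀ w, IsBallWeight n A R w →
        IsAdapted n σ R s a → ∀ k, capPart (hDensity n σ R) s a k ≠ 0 →
          Comparable C (capNorm (hDensity n σ R) s a w k) (R ^ capExp n) := by
  have hmean := capMean_pos n
  have hball := volume_real_ball_pos (d := n + 1) one_pos
  filter_upwards [eventually_comparable (by positivity :
      0 < (A⁻¹) ^ (pCrit n)⁻¹ * (capMean n *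
        volume.real (Metric.ball (0 : E (n + 1)) 1) ^ (pCrit n)⁻¹))
    (capBound n * (A * weightMass n) ^ (pCrit n)⁻¹)] with C hC σ R hσ hR s a hs w hw had k hk
  obtain ⟨l, hl, rfl, -⟩ := had.exists_freq hσ hR hs hk
  exact hC _ _ (by positivity) (le_capNorm hn hA hσ hR hs hw hl)
    (capNorm_le hn hA.le hσ hR hs hw _)

theorem eventually_comparable_capSum_two (hn : 1 ≤ n) (hA : 0 < A) :
    ∀ᶠ C : ℝ in atTop, ∀ σ R : ℝ, 0 < σ → σ < 1 / 2 → 1 < R →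
      ∀ (s : ℝ) (a : Fin n → ℝ), IsCapSide R s → ∀ w, IsBallWeight n A R w →
        Comparable C (capSum (hDensity n σ R) s a w 2) (R ^ sharpExp n σ) := by
  obtain ⟨C₀, hC₀⟩ := exists_capSum_le hn hA.le two_pos
  obtain ⟨c, hc0, hc⟩ := exists_le_capSum hn hA two_pos
  filter_upwards [eventually_comparable hc0 C₀] with C hC σ R hσ hσ' hR s a hs w hw
  rw [← rpow_half_mul_rpow_capExp (by linarith)]
  exact hC _ _ (by positivity) (hc σ R s hσ hσ' hR hs a w hw) (hC₀ σ R s hσ' hR hs a w hw)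

theorem eventually_capSum_two_le_lpOn (hn : 1 ≤ n) (hA : 0 ≤ A) :
    ∀ᶠ C : ℝ in atTop, ∀ σ R : ℝ, 0 < σ → σ < 1 / 2 → 1 < R →
      ∀ (s : ℝ) (a : Fin n → ℝ), IsCapSide R s → ∀ w, IsBallWeight n A R w →
        capSum (hDensity n σ R) s a w 2 ≤
          ENNReal.ofReal C * lpOn (g n σ R) (Metric.ball 0 R) := by
  obtain ⟨C₀, hC₀⟩ := exists_capSum_le hn hA two_pos
  obtain ⟨c, hc0, hc⟩ := exists_le_lpOn_g hn
  filter_upwards [eventually_le_ofReal_mul hc0 C₀] with C hC σ R hσ hσ' hR s a hs w hw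
  have hcap := hC₀ σ R s hσ' hR hs a w hw
  rw [rpow_half_mul_rpow_capExp (by linarith)] at hcap
  have hball : lpOn (g n σ R) (X n σ R) ≤ lpOn (g n σ R) (Metric.ball 0 R) :=
    eLpNorm_mono_measure _ (Measure.restrict_mono inter_subset_right le_rfl)
  simpa only [mul_one] using hC _ _ (R ^ sharpExp n σ) 1 (by positivity) zero_le_one
    (by rwa [mul_one]) ((hc σ R hσ hσ' hR).trans hball)

end Caps

section Packets

variable {n : ℕ} {A : ℝ} (φ : Profile (n + 1))

theorem eventually_magnitude_le : ∀ᶠ C : ℝ in atTop, ∀ σ R : ℝ, σ < 1 / 2 → 1 < R →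
    ∀ (K s : ℝ) (a : Fin n → ℝ), IsCapSide R s → ∀ (𝔅 : CapBoxes n R K s a) k m,
      magnitude φ 𝔅 (hDensity n σ R) k m ≤ ENNReal.ofReal (C * R ^ (-(n : ℝ))) := by
  obtain ⟨Cφ, hCφ⟩ := φ.exists_norm_le
  filter_upwards [eventually_ge_atTop (Cφ * capBound n)] with C hC σ R hσ hR K s a hs 𝔅 k m
  refine (magnitude_le hCφ fun x ↦ norm_capPart_le hσ hR hs x).trans ?_
  rw [← mul_assoc]
  gcongr

theorem eventually_le_magnitude : ∀ᶠ C : ℝ in atTop, ∀ σ R : ℝ, σ < 1 / 2 → 1 < R →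
    ∀ (K s : ℝ) (a : Fin n → ℝ), IsCapSide R s → ∀ 𝔅 : CapBoxes n R K s a,
      IsAdapted n σ R s a → ∀ k m, capPart (hDensity n σ R) s a k ≠ 0 →
        (𝔅.tube k m ∩ Metric.ball 0 (C⁻¹ * R)).Nonempty →
          ENNReal.ofReal (C⁻¹ * R ^ (-(n : ℝ))) ≤ magnitude φ 𝔅 (hDensity n σ R) k m := by
  obtain ⟨c, hc0, hc⟩ := φ.exists_le_norm
  filter_upwards [eventually_inv_le (phaseRadius_pos n), eventually_inv_mul_le hc0 n]
    with C hphase hC σ R hσ hR K s a hs 𝔅 had k m hk ⟨x, hx, hxR⟩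
  have hxR' : ‖x‖ ≤ phaseRadius n * R := (mem_ball_zero_iff.1 hxR).le.trans (by gcongr)
  exact (ENNReal.ofReal_le_ofReal (hC R (by linarith))).trans
    (le_magnitude hc0.le hc hx (had.le_norm_capPart hσ hR hs hk hxR'))

theorem eventually_le_encard_packetsAt :
    ∀ᶠ C : ℝ in atTop, ∀ σ R : ℝ, 0 < σ → σ < 1 / 2 → 1 < R →
      ∀ (K s : ℝ) (a : Fin n → ℝ), IsCapSide R s → ∀ (𝔅 : CapBoxes n R K s a) (lam : ℝ),
        lam ≤ C⁻¹ * R ^ (-(n : ℝ)) → ∀ y ∈ lattice n σ R, ‖y‖ < C⁻¹ * R →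
          ENNReal.ofReal (C⁻¹ * R ^ ((n : ℝ) * σ)) ≤
            ((packetsAt φ 𝔅 (hDensity n σ R) lam y).encard : ℝ≥0∞) := by
  obtain ⟨c, hc0, hc⟩ := φ.exists_le_norm
  filter_upwards [eventually_inv_le (phaseRadius_pos n), eventually_inv_mul_le hc0 n,
    eventually_inv_le (c := (1 / 2) ^ n) (by positivity)]
    with C hphase hlow hC σ R hσ hσ' hR K s a hs 𝔅 lam hlam y hy hyR
  exact le_trans (by gcongr) (le_encard_packetsAt hσ hσ' hR hs hc0.le hc
    (hlam.trans (hlow R (by linarith))) hy (hyR.le.trans (by gcongr)))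

theorem eventually_comparable_multiplicity :
    ∀ᶠ C : ℝ in atTop, ∀ σ R : ℝ, 0 < σ → σ < 1 / 2 → 1 < R →
      ∀ (K s : ℝ) (a : Fin n → ℝ), IsCapSide R s → ∀ (𝔅 : CapBoxes n R K s a) (lam : ℝ),
        0 < lam → lam ≤ C⁻¹ * R ^ (-(n : ℝ)) →
          Comparable C (multiplicity φ 𝔅 (hDensity n σ R) lam (X n σ R)) (R ^ ((n : ℝ) * σ)) := by
  obtain ⟨c, hc0, hc⟩ := φ.exists_le_norm
  filter_upwards [eventually_inv_mul_le hc0 n,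
    eventually_comparable (c := (1 / 2) ^ n) (by positivity) (5 ^ n)]
    with C hlow hC σ R hσ hσ' hR K s a hs 𝔅 lam hlam0 hlam
  exact hC _ _ (by positivity)
    (le_multiplicity hσ hσ' hR hs hc0.le hc (hlam.trans (hlow R (by linarith))))
    (multiplicity_le hR.le hs hlam0 _)

theorem exists_refinedRHS_le (hn : 1 ≤ n) (hA : 0 ≤ A) :
    ∃ C₀ : ℝ, ∀ σ R : ℝ, σ < 1 / 2 → 1 < R → ∀ (K s : ℝ) (a : Fin n → ℝ), IsCapSide R s →
      ∀ (𝔅 : CapBoxes n R K s a) w, IsBallWeight n A R w → ∀ lam : ℝ, 0 < lam → ∀ ε : ℝ,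
        refinedRHS φ 𝔅 (hDensity n σ R) lam (X n σ R) w ε ≤
          ENNReal.ofReal (C₀ * R ^ (sharpExp n σ + ε)) := by
  obtain ⟨N, hN⟩ := exists_capSum_le hn hA (pCrit_pos hn)
  exact ⟨_, fun σ R hσ hR K s a hs 𝔅 w hw lam hlam ↦ refinedRHS_le hn (by linarith) (by positivity)
    (multiplicity_le hR.le hs hlam _) (hN σ R s hσ hR hs a w hw)⟩

theorem eventually_comparable_refinedRHS (hn : 1 ≤ n) (hA : 0 < A) :
    ∀ᶠ C : ℝ in atTop, ∀ σ R : ℝ, 0 < σ → σ < 1 / 2 → 1 < R →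
      ∀ (K s : ℝ) (a : Fin n → ℝ), IsCapSide R s → ∀ (𝔅 : CapBoxes n R K s a) w,
        IsBallWeight n A R w → ∀ lam : ℝ, 0 < lam → lam ≤ C⁻¹ * R ^ (-(n : ℝ)) → ∀ ε : ℝ,
          Comparable C (refinedRHS φ 𝔅 (hDensity n σ R) lam (X n σ R) w ε)
            (R ^ (sharpExp n σ + ε)) := by
  obtain ⟨c, hc0, hc⟩ := φ.exists_le_norm
  obtain ⟨N, hN0, hN⟩ := exists_le_capSum hn hA (pCrit_pos hn)
  obtain ⟨C₀, hC₀⟩ := exists_refinedRHS_le φ hn hA.le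
  filter_upwards [eventually_inv_mul_le hc0 n, eventually_comparable
    (by positivity : 0 < ((1 / 2 : ℝ) ^ n) ^ (1 / 2 - 1 / pCrit n) * N) C₀]
    with C hlow hC σ R hσ hσ' hR K s a hs 𝔅 w hw lam hlam0 hlam ε
  exact hC _ _ (by positivity) (le_refinedRHS hn (by linarith) (by positivity)
    (le_multiplicity hσ hσ' hR hs hc0.le hc (hlam.trans (hlow R (by linarith))))
    (hN σ R s hσ hσ' hR hs a w hw) ε) (hC₀ σ R hσ' hR K s a hs 𝔅 w hw lam hlam0 ε)

theorem eventually_refinedRHS_le_lpOn (hn : 1 ≤ n) (hA : 0 ≤ A) :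
    ∀ᶠ C : ℝ in atTop, ∀ σ R : ℝ, 0 < σ → σ < 1 / 2 → 1 < R →
      ∀ (K s : ℝ) (a : Fin n → ℝ), IsCapSide R s → ∀ (𝔅 : CapBoxes n R K s a) w,
        IsBallWeight n A R w → ∀ lam : ℝ, 0 < lam → ∀ ε : ℝ,
          refinedRHS φ 𝔅 (hDensity n σ R) lam (X n σ R) w ε ≤
            ENNReal.ofReal (C * R ^ ε) * lpOn (g n σ R) (X n σ R) := by
  obtain ⟨C₀, hC₀⟩ := exists_refinedRHS_le φ hn hA
  obtain ⟨c, hc0, hc⟩ := exists_le_lpOn_g hn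
  filter_upwards [eventually_le_ofReal_mul hc0 C₀]
    with C hC σ R hσ hσ' hR K s a hs 𝔅 w hw lam hlam ε
  have hRHS := hC₀ σ R hσ' hR K s a hs 𝔅 w hw lam hlam ε
  rw [Real.rpow_add (by linarith)] at hRHS
  exact hC _ _ _ _ (by positivity) (by positivity) hRHS (hc σ R hσ hσ' hR)

end Packets

end BBCRV

theorem mainTheorem1 (n : ℕ) (hn : 1 ≤ n) :
    -- size of `g`, measure of `X`, and the left-hand side of refined decoupling
    (∃ C : ℝ, 1 ≤ C ∧ ∀ σ R : ℝ, 0 < σ → σ < 1 / 2 → 1 < R →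
      (∀ x, ‖BBCRV.g n σ R x‖ ≤ C * R ^ ((n : ℝ) * (σ - 1))) ∧
      (∀ y ∈ BBCRV.lattice n σ R, ‖y‖ < C⁻¹ * R → ∀ x, dist x y ≤ C⁻¹ →
        C⁻¹ * R ^ ((n : ℝ) * (σ - 1)) ≤ ‖BBCRV.g n σ R x‖) ∧
      BBCRV.Comparable C (MeasureTheory.volume (BBCRV.X n σ R))
        (R ^ (((n : ℝ) + 1) - ((n : ℝ) + 2) * σ)) ∧
      BBCRV.Comparable C (BBCRV.lpOn (BBCRV.g n σ R) (BBCRV.X n σ R))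
        (R ^ BBCRV.sharpExp n σ)) ∧
    -- the functions `g_θ`, and sharpness for Bourgain–Demeter decoupling
    (∀ A : ℝ, 1 ≤ A → ∃ C : ℝ, 1 ≤ C ∧ ∀ σ R : ℝ, 0 < σ → σ < 1 / 2 → 1 < R →
      ∀ (s : ℝ) (a : Fin n → ℝ), BBCRV.IsCapSide R s →
      ∀ w : BBCRV.E (n + 1) → ENNReal, BBCRV.IsBallWeight n A R w →
      (∀ k x, ‖BBCRV.capPart (BBCRV.hDensity n σ R) s a k x‖ ≤ C * R ^ (-(n : ℝ))) ∧
      (∀ k, BBCRV.capNorm (BBCRV.hDensity n σ R) s a w k ≤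
        ENNReal.ofReal (C * R ^ (-(n : ℝ) + ((n : ℝ) + 1) / BBCRV.pCrit n))) ∧
      (BBCRV.IsAdapted n σ R s a → ∀ k, BBCRV.capPart (BBCRV.hDensity n σ R) s a k ≠ 0 →
        (∀ x, ‖x‖ < C⁻¹ * R →
          C⁻¹ * R ^ (-(n : ℝ)) ≤ ‖BBCRV.capPart (BBCRV.hDensity n σ R) s a k x‖) ∧
        BBCRV.Comparable C (BBCRV.capNorm (BBCRV.hDensity n σ R) s a w k)
          (R ^ (-(n : ℝ) + ((n : ℝ) + 1) / BBCRV.pCrit n))) ∧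
      BBCRV.Comparable C (BBCRV.capSum (BBCRV.hDensity n σ R) s a w 2)
        (R ^ BBCRV.sharpExp n σ) ∧
      BBCRV.capSum (BBCRV.hDensity n σ R) s a w 2 ≤
        ENNReal.ofReal C * BBCRV.lpOn (BBCRV.g n σ R) (Metric.ball 0 R)) ∧
    -- wave packets, the multiplicity `M`, and the right-hand side of refined decoupling
    (∀ (A : ℝ) (φ : BBCRV.Profile (n + 1)), 1 ≤ A → ∃ C : ℝ, 1 ≤ C ∧
      ∀ σ R : ℝ, 0 < σ → σ < 1 / 2 → 1 < R →
      ∀ (K s : ℝ) (a : Fin n → ℝ), 1 ≤ K → BBCRV.IsCapSide R s →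
      ∀ (𝔅 : BBCRV.CapBoxes n R K s a) (w : BBCRV.E (n + 1) → ENNReal),
      BBCRV.IsBallWeight n A R w →
      (∀ k m, BBCRV.magnitude φ 𝔅 (BBCRV.hDensity n σ R) k m ≤
        ENNReal.ofReal (C * R ^ (-(n : ℝ)))) ∧
      (BBCRV.IsAdapted n σ R s a → ∀ k m, BBCRV.capPart (BBCRV.hDensity n σ R) s a k ≠ 0 →
        (𝔅.tube k m ∩ Metric.ball 0 (C⁻¹ * R)).Nonempty →
        ENNReal.ofReal (C⁻¹ * R ^ (-(n : ℝ))) ≤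
          BBCRV.magnitude φ 𝔅 (BBCRV.hDensity n σ R) k m) ∧
      ∀ lam : ℝ, 0 < lam → lam ≤ C⁻¹ * R ^ (-(n : ℝ)) →
        (∀ y ∈ BBCRV.lattice n σ R, ‖y‖ < C⁻¹ * R →
          ENNReal.ofReal (C⁻¹ * R ^ ((n : ℝ) * σ)) ≤
            ((BBCRV.packetsAt φ 𝔅 (BBCRV.hDensity n σ R) lam y).encard : ENNReal)) ∧
        BBCRV.Comparable C
          (BBCRV.multiplicity φ 𝔅 (BBCRV.hDensity n σ R) lam (BBCRV.X n σ R))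
          (R ^ ((n : ℝ) * σ)) ∧
        ∀ ε : ℝ,
          BBCRV.Comparable C
            (BBCRV.refinedRHS φ 𝔅 (BBCRV.hDensity n σ R) lam (BBCRV.X n σ R) w ε)
            (R ^ (BBCRV.sharpExp n σ + ε)) ∧
          BBCRV.refinedRHS φ 𝔅 (BBCRV.hDensity n σ R) lam (BBCRV.X n σ R) w ε ≤
            ENNReal.ofReal (C * R ^ ε) * BBCRV.lpOn (BBCRV.g n σ R) (BBCRV.X n σ R)) ∧
    -- grids of caps adapted to `g` exist
    (∀ σ R : ℝ, 0 < σ → σ < 1 / 2 → 16 ≤ R →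
      ∃ (s : ℝ) (a : Fin n → ℝ), BBCRV.IsCapSide R s ∧ BBCRV.IsAdapted n σ R s a) := by
  open Filter BBCRV in
  refine ⟨?_, fun A hA ↦ ?_, fun A φ hA ↦ ?_, fun _ _ _ ↦ exists_isAdapted⟩
  · obtain ⟨C, hC, hle, hge, hX, hlp⟩ := ((eventually_ge_atTop 1).and <|
      eventually_norm_g_le.and <| eventually_le_norm_g.and <|
      eventually_comparable_volume_X.and <| eventually_comparable_lpOn_g hn).exists
    exact ⟨C, hC, fun σ R hσ hσ' hR ↦ ⟨hle σ R (by linarith), hge σ R hσ hσ' hR,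
      hX σ R hσ hσ' hR, hlp σ R hσ hσ' hR⟩⟩
  · have hA0 : 0 < A := by linarith
    obtain ⟨C, hC, hle, hN, hge, hN', hsum, hlp⟩ := ((eventually_ge_atTop 1).and <|
      eventually_norm_capPart_le.and <| (eventually_capNorm_le hn hA0.le).and <|
      eventually_le_norm_capPart.and <| (eventually_comparable_capNorm hn hA0).and <|
      (eventually_comparable_capSum_two hn hA0).and <|
      eventually_capSum_two_le_lpOn hn hA0.le).exists
    exact ⟨C, hC, fun σ R hσ hσ' hR s a hs w hw ↦ ⟨hle σ R hσ' hR s a hs,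
      hN σ R hσ' hR s a hs w hw, fun had k hk ↦ ⟨hge σ R hσ' hR s a hs had k hk,
        hN' σ R hσ' hR s a hs w hw had k hk⟩,
      hsum σ R hσ hσ' hR s a hs w hw, hlp σ R hσ hσ' hR s a hs w hw⟩⟩
  · have hA0 : 0 < A := by linarith
    obtain ⟨C, hC, hle, hge, hpack, hmult, hrhs, hlp⟩ := ((eventually_ge_atTop 1).and <|
      (eventually_magnitude_le φ).and <| (eventually_le_magnitude φ).and <|
      (eventually_le_encard_packetsAt φ).and <| (eventually_comparable_multiplicity φ).and <|
      (eventually_comparable_refinedRHS φ hn hA0).and <|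
      eventually_refinedRHS_le_lpOn φ hn hA0.le).exists
    exact ⟨C, hC, fun σ R hσ hσ' hR K s a _ hs 𝔅 w hw ↦ ⟨hle σ R hσ' hR K s a hs 𝔅,
      hge σ R hσ' hR K s a hs 𝔅, fun lam hlam0 hlam ↦
      ⟨hpack σ R hσ hσ' hR K s a hs 𝔅 lam hlam, hmult σ R hσ hσ' hR K s a hs 𝔅 lam hlam0 hlam,
        fun ε ↦ ⟨hrhs σ R hσ hσ' hR K s a hs 𝔅 w hw lam hlam0 hlam ε,
          hlp σ R hσ hσ' hR K s a hs 𝔅 w hw lam hlam0 ε⟩⟩⟩⟩
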